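/- **Setting.** Let $h:\mathbb R^m\to\mathbb R\cup\{+\infty\}$ be convex and piecewise linear-quadratic (PLQ). PLQ means that $h$ is proper (in particular $\operatorname{dom}h:=\{z: h(z)<\infty\}\neq\emptyset$) and that $\operatorname{dom}h$ is a union of finitely many polyhedral sets, on each of which $h$ is given by an expression $\tfrac12\langle z,Qz\rangle+\langle b,z\rangle+\beta$ with $Q$ symmetric, $b\in\mathbb R^m$, $\beta\in\mathbb R$. Let $c:\mathbb R^n\to\mathbb R^m$ be $\mathcal C^2$, put $f:=h\circ c$, and let $\bar x\in\operatorname{dom}f$. All norms are Euclidean, and $\nabla c(x)$ is the Jacobian of $c$. For a convex function, $\partial$ is the convex subdifferential; $N(\cdot\,|\,\operatorname{dom}h)$ is the normal cone of the convex set $\operatorname{dom}h$; and $h^\star(y)=\sup_z\{\langle z,y\rangle-h(z)\}$. Assume the basic constraint qualification $$\operatorname{Null}(\nabla c(\bar x)^\top)\cap N(c(\bar x)\,|\,\operatorname{dom}h)=\{0\}.$$ **Notation.** Put $M(\bar x):=\operatorname{Null}(\nabla c(\bar x)^\top)\cap\partial h(c(\bar x))$ and $(yc)(x):=\langle y,c(x)\rangle$,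 and $$df(\bar x)(d):=\liminf_{t\searrow0,\ d'\to d}\frac{f(\bar x+td')-f(\bar x)}{t},\qquad D(\bar x):=\{d\in\mathbb R^n: df(\bar x)(d)\le0\},$$ $$h'(z;w):=\lim_{t\searrow0}\frac{h(z+tw)-h(z)}{t},\qquad h''(z;w):=\lim_{t\searrow0}\frac{h(z+tw)-h(z)-t\,h'(z;w)}{\frac12t^2}.$$ The *second-order sufficient conditions* at $\bar x$ are: $0\in\nabla c(\bar x)^\top\partial h(c(\bar x))$, and for every $d\in D(\bar x)\setminus\{0\}$ $$h''(c(\bar x);\nabla c(\bar x)d)+\max\{\langle d,\nabla^2(yc)(\bar x)d\rangle : y\in M(\bar x)\}>0 .$$ The point $\bar x$ is a *strong local minimizer* of $f$ if there are a neighborhood $U$ of $\bar x$ and $\gamma>0$ with $f(x)\ge f(\bar x)+\gamma\|x-\bar x\|^2$ for all $x\in U\cap\operatorname{dom}f$. The *KKT mapping* $g+G:\mathbb R^{n+m}\rightrightarrows\mathbb R^{n+m}$ is given by $$g(x,y)=\begin{pmatrix}\nabla c(x)^\top y\\-c(x)\end{pmatrix},\qquad G(x,y)=\begin{pmatrix}\{0\}\\\partial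 h^\star(y)\end{pmatrix}.$$ A set-valued mapping $S$ is *strongly metrically subregular* at $\bar z$ for $\bar w$ if $\bar w\in S(\bar z)$ and there are $\kappa\ge0$ and a neighborhood $U$ of $\bar z$ with $\|z-\bar z\|\le\kappa\operatorname{dist}(\bar w,S(z))$ for all $z\in U$, where $\operatorname{dist}(\bar w,\emptyset)=\infty$. **Theorem.** For every $\bar y\in\mathbb R^m$ the following are equivalent: 1. $M(\bar x)=\{\bar y\}$, and the second-order sufficient conditions hold at $\bar x$. 2. $g+G$ is strongly metrically subregular at $(\bar x,\bar y)$ for $0$, and $\bar x$ is a strong local minimizer of $f$. -/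

import Mathlib

open Filter Topology

namespace ConvexComposite

noncomputable section

/-- The Euclidean space `ℝⁿ`. -/
abbrev E (n : ℕ) : Type := EuclideanSpace ℝ (Fin n)

/-- The domain `{x | φ x < ∞}` of an extended-real-valued function. -/
def dom {X : Type*} (φ : X → EReal) : Set X := {x | φ x < ⊤}

/-- `φ` is proper: its domain is nonempty and it never takes the value `-∞`. -/
def IsProper {X : Type*} (φ : X → EReal) : Prop :=
  (dom φ).Nonempty ∧ ∀ x, φ x ≠ ⊥

/-- `φ` is convex: its epigraph is a convex subset of `ℝᵐ × ℝ`. -/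
def IsConvexFun {m : ℕ} (φ : E m → EReal) : Prop :=
  Convex ℝ {p : E m × ℝ | φ p.1 ≤ (p.2 : EReal)}

/-- A polyhedral set: the solution set of finitely many weak affine inequalities. -/
def IsPolyhedralSet {m : ℕ} (C : Set (E m)) : Prop :=
  ∃ (s : ℕ) (a : Fin s → E m) (α : Fin s → ℝ), C = {z | ∀ j, inner ℝ (a j) z ≤ α j}

/-- `h` is piecewise linear-quadratic: `h` is proper and `dom h` is a union of finitely many
polyhedral sets, on each of which `h z = ½⟨z, Q z⟩ + ⟨b, z⟩ + β` with `Q` symmetric. -/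
def IsPLQ {m : ℕ} (h : E m → EReal) : Prop :=
  IsProper h ∧
  ∃ (K : ℕ) (C : Fin K → Set (E m)) (Q : Fin K → (E m →ₗ[ℝ] E m)) (b : Fin K → E m)
    (β : Fin K → ℝ),
    dom h = ⋃ k, C k ∧
    ∀ k, IsPolyhedralSet (C k) ∧ (Q k).IsSymmetric ∧
      ∀ z ∈ C k,
        h z = (((1 / 2 : ℝ) * inner ℝ z (Q k z) + inner ℝ (b k) z + β k : ℝ) : EReal)

/-- The subdifferential of a convex function: all `v` satisfying the subgradient inequality
`φ z ≥ φ x + ⟨v, z - x⟩`, at points `x` where `φ` is finite (and empty elsewhere). -/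
def subdiff {m : ℕ} (φ : E m → EReal) (x : E m) : Set (E m) :=
  {v | φ x ≠ ⊤ ∧ φ x ≠ ⊥ ∧ ∀ z, φ x + ((inner ℝ v (z - x) : ℝ) : EReal) ≤ φ z}

/-- The normal cone to a convex set `C` at a point `x ∈ C`. -/
def normalCone {m : ℕ} (C : Set (E m)) (x : E m) : Set (E m) :=
  {v | ∀ z ∈ C, inner ℝ v (z - x) ≤ 0}

/-- The Fenchel conjugate `h⋆(y) = sup_z ⟨z, y⟩ - h z`. -/
def conjugate {m : ℕ} (h : E m → EReal) (y : E m) : EReal :=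
  ⨆ z : E m, ((inner ℝ z y : ℝ) : EReal) - h z

/-- `∇c(x)ᵀ`, the transpose of the Jacobian of `c` at `x`. -/
def jacT {n m : ℕ} (c : E n → E m) (x : E n) : E m →L[ℝ] E n :=
  ContinuousLinearMap.adjoint (fderiv ℝ c x)

/-- `∇²(yc)(x)`, the Hessian at `x` of the scalar function `(yc)(u) = ⟨y, c u⟩`. -/
def hessLag {n m : ℕ} (c : E n → E m) (y : E m) (x : E n) : E n →L[ℝ] E n :=
  fderiv ℝ (gradient (fun u : E n => (inner ℝ y (c u) : ℝ))) x

/-- The subderivative `df(x)(w) = liminf_{t ↘ 0, w' → w} (f(x + t w') - f(x)) / t`. -/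
def subderiv {n : ℕ} (f : E n → EReal) (x w : E n) : EReal :=
  liminf (fun p : ℝ × E n => (f (x + p.1 • p.2) - f x) / (p.1 : EReal))
    (𝓝[>] (0 : ℝ) ×ˢ 𝓝 w)

/-- The one-sided directional derivative `h'(x; w)` exists in `[-∞, ∞]` and equals `L`. -/
def HasDirDeriv {m : ℕ} (h : E m → EReal) (x w : E m) (L : EReal) : Prop :=
  Tendsto (fun t : ℝ => (h (x + t • w) - h x) / (t : EReal)) (𝓝[>] 0) (𝓝 L)

/-- The one-sided second directional derivative `h''(x; w)` exists in `[-∞, ∞]` and equals `q`: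
`h'(x; w)` exists and is a real number `r`, and
`(h(x + t w) - h(x) - t r) / (t² / 2) → q` as `t ↘ 0`. -/
def HasSecondDirDeriv {m : ℕ} (h : E m → EReal) (x w : E m) (q : EReal) : Prop :=
  ∃ r : ℝ, HasDirDeriv h x w (r : EReal) ∧
    Tendsto (fun t : ℝ =>
        (h (x + t • w) - h x - ((t * r : ℝ) : EReal)) / ((t ^ 2 / 2 : ℝ) : EReal))
      (𝓝[>] 0) (𝓝 q)

/-- The directions of non-ascent `D(x) = {d | df(x)(d) ≤ 0}`. -/
def nonAscent {n : ℕ} (f : E n → EReal) (x : E n) : Set (E n) :=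
  {d | subderiv f x d ≤ 0}

/-- The basic constraint qualification `Null ∇c(x)ᵀ ∩ N(c(x) | dom h) = {0}`. -/
def BCQ {n m : ℕ} (h : E m → EReal) (c : E n → E m) (x : E n) : Prop :=
  {y | jacT c x y = 0} ∩ normalCone (dom h) (c x) = {0}

/-- The multiplier set `M(x) = Null ∇c(x)ᵀ ∩ ∂h(c(x))`. -/
def multipliers {n m : ℕ} (h : E m → EReal) (c : E n → E m) (x : E n) : Set (E m) :=
  {y | jacT c x y = 0} ∩ subdiff h (c x)

/-- The second-order sufficient conditions for `f = h ∘ c` at `x`: `0 ∈ ∇c(x)ᵀ ∂h(c(x))` and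
`h''(c(x); ∇c(x) d) + max {⟨d, ∇²(yc)(x) d⟩ | y ∈ M(x)} > 0` for all `d ∈ D(x) \ {0}`. -/
def SecondOrderSufficient {n m : ℕ} (h : E m → EReal) (c : E n → E m) (x : E n) : Prop :=
  (0 : E n) ∈ jacT c x '' subdiff h (c x) ∧
  ∀ d ∈ nonAscent (h ∘ c) x \ {0}, ∃ (q : EReal) (μ : ℝ),
    HasSecondDirDeriv h (c x) (fderiv ℝ c x d) q ∧
    IsGreatest ((fun y => (inner ℝ d (hessLag c y x d) : ℝ)) '' multipliers h c x) μ ∧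
    0 < q + (μ : EReal)

/-- `x` is a strong local minimizer of `f`: for some neighbourhood `U` of `x` and some `γ > 0`,
`f u ≥ f x + γ ‖u - x‖²` for all `u ∈ U ∩ dom f`. -/
def IsStrongLocalMin {n : ℕ} (f : E n → EReal) (x : E n) : Prop :=
  ∃ U ∈ 𝓝 x, ∃ γ : ℝ, 0 < γ ∧
    ∀ u ∈ U ∩ dom f, f x + ((γ * ‖u - x‖ ^ 2 : ℝ) : EReal) ≤ f u

/-- The set-valued mapping `S` is strongly metrically subregular at `x` for `y`: `y ∈ S x`, and
`‖u - x‖ ≤ κ dist(y, S u)` for some `κ ≥ 0` and all `u` near `x`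
(the distance to the empty set is `∞`). -/
def StronglyMetricallySubregular {X Y : Type*} [PseudoEMetricSpace X] [PseudoEMetricSpace Y]
    (S : X → Set Y) (x : X) (y : Y) : Prop :=
  y ∈ S x ∧ ∃ κ : NNReal, ∃ U ∈ 𝓝 x, ∀ u ∈ U, edist u x ≤ (κ : ENNReal) * Metric.infEDist y (S u)

/-- `ℝⁿ⁺ᵐ`, i.e. the pairs `(x, y) ∈ ℝⁿ × ℝᵐ` with the Euclidean norm. -/
abbrev PrimalDual (n m : ℕ) : Type := WithLp 2 (E n × E m)

/-- The single-valued part `g(x, y) = (∇c(x)ᵀ y, -c(x))` of the KKT mapping. -/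
def kktG {n m : ℕ} (c : E n → E m) (z : PrimalDual n m) : PrimalDual n m :=
  WithLp.toLp 2 (jacT c z.fst z.snd, -c z.fst)

/-- The set-valued part `G(x, y) = {0} × ∂h⋆(y)` of the KKT mapping. -/
def kktSet {n m : ℕ} (h : E m → EReal) (z : PrimalDual n m) : Set (PrimalDual n m) :=
  {w | w.fst = 0 ∧ w.snd ∈ subdiff (conjugate h) z.snd}

/-- The KKT mapping `g + G`. -/
def kktMap {n m : ℕ} (h : E m → EReal) (c : E n → E m) (z : PrimalDual n m) :
    Set (PrimalDual n m) :=
  (fun w => kktG c z + w) '' kktSet h z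

end

end ConvexComposite

namespace ConvexComposite

/-! Write A for the Jacobian ∇c(xbar). Near c(xbar) the function h is quadratic on finitely many
polyhedral cones (`LocalModel`), with gradient g and Hessian Q on each. So in a limit of difference
quotients a single piece can be assumed to govern the whole sequence (`LocalModel.exists_piece`).

From 1 to 2. A sequence violating quadratic growth has a limiting unit direction d in D(xbar). Since
ybar annihilates the range of A and is a subgradient, comparing h with ybar removes the first-order
terms; what remains after division by t² contradicts the second-order condition at d. A sequence
violating subregularity yields a unit pair (d, e) with ∇²(ybar c)(xbar) d + Aᵀe = 0 and ⟨Ad, QAd⟩ ≤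
⟨e, Ad⟩. Pairing the equation with d contradicts the second-order condition unless d = 0. Then Aᵀe =
0 and e lies in the polar of the critical cone of h at ybar. By Farkas' lemma ybar + τe is a
subgradient for some τ > 0 (`exists_add_smul_mem_subdiff`), hence a multiplier, so uniqueness forces
e = 0, which is impossible.

From 2 to 1. Subregularity isolates (xbar, ybar) among the solutions; as the multiplier set is
convex, it is {ybar}. The constraint qualification gives metric regularity of c(x) ∈ dom h, which
transfers the growth of f to the penalty function h(z) + L‖z - c(x)‖
(`IsStrongLocalMin.exists_penalized_growth`). Along parabolic arcs this becomes a lower bound for a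
convex problem (`le_of_penalized_growth`), and separation turns the bound into a multiplier
(`exists_multiplier_of_forall_le`). That multiplier can only be ybar, and the bound is then the
second-order condition. -/

/-! ### Farkas' lemma and domination on polyhedral cones. -/

/-- Farkas' lemma for finitely many linear forms. -/
theorem exists_nonneg_combination_of_forall_nonpos {V : Type*} [AddCommGroup V] [Module ℝ V] :
    ∀ {s : ℕ} (f : Fin s → V →ₗ[ℝ] ℝ) (e : V →ₗ[ℝ] ℝ),
      (∀ v, (∀ i, f i v ≤ 0) → e v ≤ 0) →
      ∃ c : Fin s → ℝ, (∀ i, 0 ≤ c i) ∧ e = ∑ i, c i • f i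
  | 0, _, e, he => by
    refine ⟨fun _ => 0, fun _ => le_rfl, ?_⟩
    ext v
    have h1 := he v (fun i => i.elim0)
    have h2 := he (-v) (fun i => i.elim0)
    rw [map_neg] at h2
    simp only [Finset.univ_eq_empty, Finset.sum_empty, LinearMap.zero_apply]
    linarith
  | s + 1, f, e, he => by
    by_cases hcase : ∀ v, (∀ i : Fin s, f i.castSucc v ≤ 0) → e v ≤ 0
    · obtain ⟨c, hc, hec⟩ :=
        exists_nonneg_combination_of_forall_nonpos (fun i : Fin s => f i.castSucc) e hcase
      refine ⟨Fin.snoc c 0, fun i => ?_, ?_⟩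
      · refine Fin.lastCases ?_ (fun i => ?_) i
        · simp
        · simpa using hc i
      · rw [Fin.sum_univ_castSucc]
        simpa using hec
    · push Not at hcase
      obtain ⟨x₀, hx₀, hex₀⟩ := hcase
      have hl₀ : 0 < f (Fin.last s) x₀ := by
        by_contra hneg
        refine absurd (he x₀ fun i => ?_) (not_le.2 hex₀)
        refine Fin.lastCases (not_lt.1 hneg) (fun i => hx₀ i) i
      -- With this scaling, v ↦ v - f_last(v) x projects onto the kernel of the last form; the
      -- induction hypothesis is applied to the forms composed with this projection.
      obtain ⟨x, hx, hex, hl⟩ : ∃ x, (∀ i : Fin s, f i.castSucc x ≤ 0) ∧ 0 < e x ∧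
          f (Fin.last s) x = 1 := by
        refine ⟨(f (Fin.last s) x₀)⁻¹ • x₀, fun i => ?_, ?_, ?_⟩
        · rw [map_smul, smul_eq_mul]
          exact mul_nonpos_of_nonneg_of_nonpos (inv_pos.2 hl₀).le (hx₀ i)
        · rw [map_smul, smul_eq_mul]
          exact mul_pos (inv_pos.2 hl₀) hex₀
        · rw [map_smul, smul_eq_mul, inv_mul_cancel₀ hl₀.ne']
      obtain ⟨c, hc, hec⟩ := exists_nonneg_combination_of_forall_nonpos
        (fun i : Fin s => f i.castSucc - f i.castSucc x • f (Fin.last s))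
        (e - e x • f (Fin.last s)) (fun v hv => by
          have := he (v - f (Fin.last s) v • x) (fun i => by
            refine Fin.lastCases ?_ (fun i => ?_) i
            · simp [hl]
            · have := hv i
              simp only [LinearMap.sub_apply, LinearMap.smul_apply, smul_eq_mul] at this
              simp only [map_sub, map_smul, smul_eq_mul]
              linarith)
          simp only [map_sub, map_smul, smul_eq_mul] at this
          simp only [LinearMap.sub_apply, LinearMap.smul_apply, smul_eq_mul]
          linarith)
      -- Undoing the projection produces this last coefficient; it is nonnegative because e x > 0
      -- and every f_i x ≤ 0.
      refine ⟨Fin.snoc c (e x - ∑ i, c i * f i.castSucc x), fun i => ?_, ?_⟩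
      · refine Fin.lastCases ?_ (fun i => ?_) i
        · have : ∑ i, c i * f i.castSucc x ≤ 0 :=
            Finset.sum_nonpos fun i _ => mul_nonpos_of_nonneg_of_nonpos (hc i) (hx i)
          simp only [Fin.snoc_last]
          linarith
        · simpa using hc i
      · rw [Fin.sum_univ_castSucc]
        ext v
        have := LinearMap.congr_fun hec v
        simp only [LinearMap.sub_apply, LinearMap.smul_apply, smul_eq_mul, LinearMap.sum_apply,
          mul_sub, Finset.sum_sub_distrib] at this
        simp only [Fin.snoc_castSucc, Fin.snoc_last, LinearMap.add_apply, LinearMap.sum_apply,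
          LinearMap.smul_apply, smul_eq_mul, sub_mul, Finset.sum_mul]
        simp only [← mul_assoc] at this
        linarith

/-- If `u` is nonnegative on a polyhedral cone and `e` is nonpositive where `u` vanishes there,
then `e` is dominated on the cone by a multiple of `u`. -/
theorem exists_inner_le_mul_inner {m s : ℕ} (a : Fin s → E m) (u e : E m)
    (hu : ∀ v, (∀ j, inner ℝ (a j) v ≤ 0) → 0 ≤ inner ℝ u v)
    (he : ∀ v, (∀ j, inner ℝ (a j) v ≤ 0) → inner ℝ u v = 0 → inner ℝ e v ≤ 0) :
    ∃ μ : ℝ, 0 ≤ μ ∧ ∀ v, (∀ j, inner ℝ (a j) v ≤ 0) → inner ℝ e v ≤ μ * inner ℝ u v := by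
  -- The constraint u ≤ 0 is adjoined to those of the cone, where it forces u = 0. Its Farkas
  -- coefficient is the required multiple.
  obtain ⟨c, hc, hec⟩ := exists_nonneg_combination_of_forall_nonpos
    (Fin.cons (innerₗ (E m) u) (fun j => innerₗ (E m) (a j)) : Fin (s + 1) → E m →ₗ[ℝ] ℝ)
    (innerₗ (E m) e) (fun v hv => by
      have h0 : inner ℝ u v ≤ 0 := by simpa using hv 0
      have hj : ∀ j, inner ℝ (a j) v ≤ 0 := fun j => by simpa using hv j.succ
      exact he v hj (le_antisymm h0 (hu v hj)))
  refine ⟨c 0, hc 0, fun v hv => ?_⟩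
  have h1 := LinearMap.congr_fun hec v
  rw [Fin.sum_univ_succ] at h1
  simp only [innerₗ_apply_apply, Fin.cons_zero, Fin.cons_succ, LinearMap.add_apply,
    LinearMap.smul_apply, LinearMap.sum_apply, smul_eq_mul] at h1
  have : ∑ j : Fin s, c j.succ * inner ℝ (a j) v ≤ 0 :=
    Finset.sum_nonpos fun j _ => mul_nonpos_of_nonneg_of_nonpos (hc _) (hv j)
  linarith

/-! ### Polyhedral sets and their tangent cones. -/

section Polyhedral

variable {m : ℕ} {C : Set (E m)} {z w : E m}

theorem IsPolyhedralSet.isClosed (hC : IsPolyhedralSet C) : IsClosed C := by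
  obtain ⟨s, a, α, rfl⟩ := hC
  simp only [Set.ofPred_forall]
  exact isClosed_iInter fun j => isClosed_le (by fun_prop) continuous_const

theorem IsPolyhedralSet.convex (hC : IsPolyhedralSet C) : Convex ℝ C := by
  obtain ⟨s, a, α, rfl⟩ := hC
  simp only [Set.ofPred_forall]
  exact convex_iInter fun j =>
    convex_halfSpace_le (innerₗ (E m) (a j)).isLinear (α j)

/-- The tangent cone to a polyhedral set at one of its points is a polyhedral cone, and the set
coincides with its tangent cone near the point. -/
theorem IsPolyhedralSet.exists_tangent (hC : IsPolyhedralSet C) (hz : z ∈ C) :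
    ∃ (s : ℕ) (a : Fin s → E m), (∀ z' ∈ C, ∀ j, inner ℝ (a j) (z' - z) ≤ 0) ∧
      ∀ w, (∀ j, inner ℝ (a j) w ≤ 0) → ∃ ε : ℝ, 0 < ε ∧ ∀ t, 0 ≤ t → t ≤ ε → z + t • w ∈ C := by
  classical
  have hconv := hC.convex
  obtain ⟨s, a, α, rfl⟩ := hC
  -- Only the constraints active at z matter; inactive ones become the zero vector, which keeps the
  -- index type.
  refine ⟨s, fun j => if inner ℝ (a j) z = α j then a j else 0, fun z' hz' j => ?_, fun w hw => ?_⟩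
  · dsimp only
    split_ifs with hj
    · rw [inner_sub_right, hj]
      linarith [hz' j]
    · simp
  · have key : ∀ j, ∀ᶠ t in 𝓝[>] (0 : ℝ), inner ℝ (a j) (z + t • w) ≤ α j := fun j => by
      by_cases hj : inner ℝ (a j) z = α j
      · filter_upwards [self_mem_nhdsWithin] with t ht
        have := hw j
        simp only [if_pos hj] at this
        rw [inner_add_right, inner_smul_right, hj]
        linarith [mul_nonpos_of_nonneg_of_nonpos (le_of_lt (Set.mem_Ioi.1 ht)) this]
      · have hlt : inner ℝ (a j) (z + (0 : ℝ) • w) < α j := by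
          simpa using lt_of_le_of_ne (hz j) hj
        have hcont : Continuous fun t : ℝ => inner ℝ (a j) (z + t • w) := by fun_prop
        exact ((hcont.tendsto 0).mono_left nhdsWithin_le_nhds).eventually_le_const hlt
    -- One good parameter is enough: convexity fills in the segment back to z.
    obtain ⟨ε, hε, hpos⟩ := ((eventually_all.2 key).and self_mem_nhdsWithin).exists
    refine ⟨ε, hpos, fun t ht0 htε => ?_⟩
    have hpos' : 0 < ε := hpos
    have := hconv.add_smul_mem hz (y := ε • w) hε (t := t / ε)
      ⟨by positivity, (div_le_one hpos').2 htε⟩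
    rwa [smul_smul, div_mul_cancel₀ _ hpos'.ne'] at this

end Polyhedral

/-! ### Passing from extended-real to real values. -/

section ExtendedReal

variable {X : Type*} {φ : X → EReal} {x : X}

theorem IsProper.coe_toReal (hφ : IsProper φ) (hx : x ∈ dom φ) :
    (((φ x).toReal : ℝ) : EReal) = φ x :=
  EReal.coe_toReal (ne_of_lt hx) (hφ.2 x)

theorem mem_dom_of_eq_coe {r : ℝ} (hx : φ x = (r : EReal)) : x ∈ dom φ := by
  simp only [dom, Set.mem_ofPred_eq, hx, EReal.coe_lt_top]

theorem mem_dom_of_le_coe {r : ℝ} (hx : φ x ≤ (r : EReal)) : x ∈ dom φ :=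
  lt_of_le_of_lt hx (EReal.coe_lt_top r)

theorem IsProper.le_coe_iff (hφ : IsProper φ) (hx : x ∈ dom φ) {r : ℝ} :
    φ x ≤ (r : EReal) ↔ (φ x).toReal ≤ r := by
  rw [← hφ.coe_toReal hx, EReal.coe_le_coe_iff, EReal.toReal_coe]

end ExtendedReal

/-! ### Convex piecewise linear-quadratic functions. -/

/-- A proper convex function is convex on its domain, as a real-valued function. -/
theorem IsConvexFun.convexOn {m : ℕ} {h : E m → EReal} (hprop : IsProper h)
    (hconv : IsConvexFun h) : ConvexOn ℝ (dom h) fun z => (h z).toReal := by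
  have key : ∀ x ∈ dom h, ∀ y ∈ dom h, ∀ a b : ℝ, 0 ≤ a → 0 ≤ b → a + b = 1 →
      h (a • x + b • y) ≤ ((a * (h x).toReal + b * (h y).toReal : ℝ) : EReal) := by
    intro x hx y hy a b ha hb hab
    have hx' : ((x, (h x).toReal) : E m × ℝ) ∈ {p : E m × ℝ | h p.1 ≤ (p.2 : EReal)} :=
      (hprop.coe_toReal hx).ge
    have hy' : ((y, (h y).toReal) : E m × ℝ) ∈ {p : E m × ℝ | h p.1 ≤ (p.2 : EReal)} :=
      (hprop.coe_toReal hy).ge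
    exact hconv hx' hy' ha hb hab
  have hdom : Convex ℝ (dom h) := fun x hx y hy a b ha hb hab =>
    mem_dom_of_le_coe (key x hx y hy a b ha hb hab)
  exact ⟨hdom, fun x hx y hy a b ha hb hab =>
    (hprop.le_coe_iff (hdom hx hy ha hb hab)).1 (key x hx y hy a b ha hb hab)⟩

theorem IsPLQ.isClosed_dom {m : ℕ} {h : E m → EReal} (hPLQ : IsPLQ h) : IsClosed (dom h) := by
  obtain ⟨-, K, C, Q, b, β, hdom, hC⟩ := hPLQ
  rw [hdom]
  exact isClosed_iUnion_of_finite fun k => (hC k).1.isClosed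

/-- The epigraph of a piecewise linear-quadratic function is closed. -/
theorem IsPLQ.isClosed_epigraph {m : ℕ} {h : E m → EReal} (hPLQ : IsPLQ h) :
    IsClosed {p : E m × ℝ | h p.1 ≤ (p.2 : EReal)} := by
  obtain ⟨-, K, C, Q, b, β, hdom, hC⟩ := hPLQ
  have : {p : E m × ℝ | h p.1 ≤ (p.2 : EReal)} = ⋃ k, {p : E m × ℝ | p.1 ∈ C k ∧
      (1 / 2 : ℝ) * inner ℝ p.1 (Q k p.1) + inner ℝ (b k) p.1 + β k ≤ p.2} := by
    ext p
    simp only [Set.mem_ofPred_eq, Set.mem_iUnion]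
    constructor
    · intro hp
      have hp' := mem_dom_of_le_coe hp
      rw [hdom] at hp'
      obtain ⟨k, hk⟩ := Set.mem_iUnion.1 hp'
      refine ⟨k, hk, ?_⟩
      rwa [(hC k).2.2 _ hk, EReal.coe_le_coe_iff] at hp
    · rintro ⟨k, hk, hp⟩
      rwa [(hC k).2.2 _ hk, EReal.coe_le_coe_iff]
  rw [this]
  refine isClosed_iUnion_of_finite fun k =>
    IsClosed.inter ((hC k).1.isClosed.preimage continuous_fst) (isClosed_le ?_ continuous_snd)
  have hQ : Continuous (Q k) := (Q k).continuous_of_finiteDimensional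
  fun_prop

/-- A local description of a piecewise linear-quadratic function at a point `z` of its domain:
finitely many polyhedral cones, on each of which the function is a quadratic near `z`. -/
structure LocalModel {m : ℕ} (h : E m → EReal) (z : E m) where
  /-- The index type of the pieces. -/
  ι : Type
  /-- There are finitely many pieces. -/
  fin : Fintype ι
  /-- The number of inequalities. -/
  s : ι → ℕ
  /-- The normals of the cones. -/
  a : ∀ k, Fin (s k) → E m
  /-- The gradients at `z`. -/
  g : ι → E m
  /-- The Hessians. -/
  Q : ι → (E m →ₗ[ℝ] E m)
  -- The formula covers the whole segment from z to z', because a subgradient at z' is later tested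
  -- against points just before z'.
  near : ∀ᶠ z' in 𝓝 z, z' ∈ dom h → ∃ k, (∀ j, inner ℝ (a k j) (z' - z) ≤ 0) ∧
    ∀ t : ℝ, 0 ≤ t → t ≤ 1 → h (z + t • (z' - z)) = (((h z).toReal + t * inner ℝ (g k) (z' - z) +
      t ^ 2 / 2 * inner ℝ (z' - z) (Q k (z' - z)) : ℝ) : EReal)
  -- Here the radius may depend on the direction w.
  along : ∀ k w, (∀ j, inner ℝ (a k j) w ≤ 0) → ∃ ε : ℝ, 0 < ε ∧ ∀ t, 0 ≤ t → t ≤ ε →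
    h (z + t • w) = (((h z).toReal + t * inner ℝ (g k) w +
      t ^ 2 / 2 * inner ℝ w (Q k w) : ℝ) : EReal)

theorem IsPLQ.nonempty_localModel {m : ℕ} {h : E m → EReal} (hPLQ : IsPLQ h) (z : E m) :
    Nonempty (LocalModel h z) := by
  classical
  obtain ⟨-, K, C, Q, b, β, hdom, hC⟩ := hPLQ
  have htan := fun k : {k // z ∈ C k} => (hC k).1.exists_tangent k.2
  choose s a h1 h2 using htan
  have hexp : ∀ k : {k // z ∈ C k}, ∀ (t : ℝ) (w : E m), z + t • w ∈ C k →
      h (z + t • w) = (((h z).toReal + t * inner ℝ (Q k z + b k) w +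
      t ^ 2 / 2 * inner ℝ w (Q k w) : ℝ) : EReal) := by
    intro k t w hw
    rw [(hC k).2.2 _ hw, (hC k).2.2 _ k.2, EReal.toReal_coe]
    congr 1
    have hsymm : inner ℝ z (Q k w) = inner ℝ (Q k z) w := ((hC k).2.1 z w).symm
    have hsymm' : inner ℝ w (Q k z) = inner ℝ (Q k z) w := real_inner_comm _ _
    simp only [map_add, map_smul, inner_add_left, inner_add_right, inner_smul_left,
      inner_smul_right, hsymm, hsymm', RCLike.conj_to_real]
    ring
  refine ⟨⟨{k // z ∈ C k}, inferInstance, s, a, fun k => Q k z + b k, fun k => Q k, ?_, ?_⟩⟩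
  · have hfar : ∀ k, z ∉ C k → ∀ᶠ z' in 𝓝 z, z' ∉ C k := fun k hk =>
      (hC k).1.isClosed.isOpen_compl.mem_nhds hk
    have hfar' : ∀ᶠ z' in 𝓝 z, ∀ k, z ∉ C k → z' ∉ C k := by
      refine eventually_all.2 fun k => ?_
      by_cases hk : z ∈ C k
      · exact Eventually.of_forall fun _ hk' => absurd hk hk'
      · filter_upwards [hfar k hk] with z' hz' _ using hz'
    filter_upwards [hfar'] with z' hz' hd
    rw [hdom] at hd
    obtain ⟨k, hk⟩ := Set.mem_iUnion.1 hd
    have hzk : z ∈ C k := by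
      by_contra hcon
      exact hz' k hcon hk
    refine ⟨⟨k, hzk⟩, h1 ⟨k, hzk⟩ z' hk, fun t ht0 ht1 => hexp ⟨k, hzk⟩ t _ ?_⟩
    exact (hC k).1.convex.add_smul_sub_mem hzk hk ⟨ht0, ht1⟩
  · intro k w hw
    obtain ⟨ε, hε, hεC⟩ := h2 k w hw
    exact ⟨ε, hε, fun t ht0 htε => hexp k t w (hεC t ht0 htε)⟩

/-- A convex piecewise linear-quadratic function is Lipschitz continuous on its domain near each
point of the domain. -/
theorem IsPLQ.exists_lipschitz {m : ℕ} {h : E m → EReal} (hPLQ : IsPLQ h) (hconv : IsConvexFun h)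
    (z : E m) : ∃ L : ℝ, 0 ≤ L ∧ ∃ r : ℝ, 0 < r ∧ ∀ x ∈ Metric.ball z r ∩ dom h,
      ∀ y ∈ Metric.ball z r ∩ dom h, (h y).toReal ≤ (h x).toReal + L * ‖y - x‖ := by
  classical
  have hcv := hconv.convexOn hPLQ.1
  obtain ⟨-, K, C, Q, b, β, hdom, hC⟩ := hPLQ
  have hq : ∀ k, ∃ L : NNReal, ∃ U ∈ 𝓝 z, LipschitzOnWith L
      (fun z => (1 / 2 : ℝ) * inner ℝ z (Q k z) + inner ℝ (b k) z + β k) U := fun k => by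
    refine ContDiffAt.exists_lipschitzOnWith (𝕂 := ℝ) ?_
    have hQ : ContDiff ℝ 1 (Q k) := (LinearMap.toContinuousLinearMap (Q k)).contDiff
    exact (((contDiff_const.mul (contDiff_id.inner ℝ hQ)).add
      (contDiff_const.inner ℝ contDiff_id)).add contDiff_const).contDiffAt
  choose L U hU hL using hq
  obtain ⟨r, hr, hrU⟩ : ∃ r : ℝ, 0 < r ∧ Metric.ball z r ⊆ ⋂ k, U k :=
    Metric.mem_nhds_iff.1 (iInter_mem.2 hU)
  refine ⟨∑ k, (L k : ℝ), Finset.sum_nonneg fun k _ => (L k).2, r, hr, ?_⟩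
  rintro x ⟨hxr, hxd⟩ y ⟨hyr, hyd⟩
  have hmem : ∀ s : ℝ, 0 ≤ s → s ≤ 1 → y + s • (x - y) ∈ Metric.ball z r ∩ dom h := fun s h0 h1 =>
    ((convex_ball z r).inter hcv.1).add_smul_sub_mem ⟨hyr, hyd⟩ ⟨hxr, hxd⟩ ⟨h0, h1⟩
  -- There are finitely many pieces, so one of them contains points of the segment arbitrarily close
  -- to y, and then y itself by closedness.
  have hev : ∃ k, ∃ᶠ s in 𝓝[>] (0 : ℝ), y + s • (x - y) ∈ C k := by
    have : ∃ᶠ s in 𝓝[>] (0 : ℝ), ∃ k, y + s • (x - y) ∈ C k := by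
      refine Eventually.frequently ?_
      filter_upwards [Ioc_mem_nhdsGT (zero_lt_one' ℝ)] with s hs
      have := (hmem s hs.1.le hs.2).2
      rw [hdom] at this
      exact Set.mem_iUnion.1 this
    by_contra hcon
    push Not at hcon
    have h2 : ∀ᶠ s in 𝓝[>] (0 : ℝ), ∀ k, y + s • (x - y) ∉ C k :=
      eventually_all.2 fun k => hcon k
    obtain ⟨s, ⟨k, hk⟩, hs⟩ := (this.and_eventually h2).exists
    exact hs k hk
  obtain ⟨k, hk⟩ := hev
  have hyk : y ∈ C k := by
    have htend : Tendsto (fun s : ℝ => y + s • (x - y)) (𝓝[>] (0 : ℝ)) (𝓝 y) := by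
      have : Continuous fun s : ℝ => y + s • (x - y) := by fun_prop
      simpa using (this.tendsto 0).mono_left nhdsWithin_le_nhds
    exact (hC k).1.isClosed.mem_of_frequently_of_tendsto hk htend
  obtain ⟨s, hsk, hs⟩ := (hk.and_eventually (Ioc_mem_nhdsGT (zero_lt_one' ℝ))).exists
  have hs0 : 0 < s := hs.1
  have hsm := hmem s hs.1.le hs.2
  -- Convexity bounds the drop h(y) - h(x) by the difference quotient over the short initial step,
  -- which stays within one piece and is controlled by its Lipschitz constant.
  have h1 : (h (y + s • (x - y))).toReal ≤ (1 - s) * (h y).toReal + s * (h x).toReal := by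
    have := hcv.2 hyd hxd (sub_nonneg.2 hs.2) hs.1.le (sub_add_cancel 1 s)
    simp only [smul_eq_mul] at this
    have e : (1 - s) • y + s • x = y + s • (x - y) := by module
    rwa [e] at this
  have h2 := (hL k).dist_le_mul _ (Set.mem_iInter.1 (hrU hyr) k) _
    (Set.mem_iInter.1 (hrU hsm.1) k)
  have hval : ∀ v ∈ C k, (h v).toReal =
      (1 / 2 : ℝ) * inner ℝ v (Q k v) + inner ℝ (b k) v + β k := fun v hv => by
    rw [(hC k).2.2 v hv, EReal.toReal_coe]
  rw [Real.dist_eq, ← hval _ hyk, ← hval _ hsk] at h2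
  have h3 : dist y (y + s • (x - y)) = s * ‖y - x‖ := by
    rw [dist_eq_norm, sub_add_cancel_left, norm_neg, norm_smul, Real.norm_of_nonneg hs.1.le,
      norm_sub_rev]
  rw [h3] at h2
  have h4 : (L k : ℝ) ≤ ∑ k, (L k : ℝ) :=
    Finset.single_le_sum (f := fun k => (L k : ℝ)) (fun k _ => (L k).2) (Finset.mem_univ k)
  have h5 := le_of_abs_le h2
  have h6 : s * (h y).toReal ≤ s * ((h x).toReal + L k * ‖y - x‖) := by linarith
  have h7 := le_of_mul_le_mul_left h6 hs0
  have h8 := mul_le_mul_of_nonneg_right h4 (norm_nonneg (y - x))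
  linarith

/-! ### One-sided first and second directional derivatives. -/

section DirectionalDerivative

variable {m : ℕ} {h : E m → EReal} {z w : E m}

theorem hasDirDeriv_of_eventually_eq {r a q : ℝ} (hz : h z = (r : EReal))
    (hev : ∀ᶠ t in 𝓝[>] (0 : ℝ), h (z + t • w) = ((r + t * a + t ^ 2 / 2 * q : ℝ) : EReal)) :
    HasDirDeriv h z w (a : EReal) := by
  have hlim : Tendsto (fun t : ℝ => ((a + t / 2 * q : ℝ) : EReal)) (𝓝[>] 0) (𝓝 (a : EReal)) := by
    refine EReal.tendsto_coe.2 ?_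
    have : Continuous fun t : ℝ => a + t / 2 * q := by fun_prop
    simpa using (this.tendsto 0).mono_left nhdsWithin_le_nhds
  refine hlim.congr' ?_
  filter_upwards [hev, self_mem_nhdsWithin] with t ht ht0
  have ht0' : (t : ℝ) ≠ 0 := ne_of_gt ht0
  rw [ht, hz, ← EReal.coe_sub, ← EReal.coe_div]
  congr 1
  field_simp
  ring

theorem hasSecondDirDeriv_of_eventually_eq {r a q : ℝ} (hz : h z = (r : EReal))
    (hev : ∀ᶠ t in 𝓝[>] (0 : ℝ), h (z + t • w) = ((r + t * a + t ^ 2 / 2 * q : ℝ) : EReal)) :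
    HasSecondDirDeriv h z w (q : EReal) := by
  refine ⟨a, hasDirDeriv_of_eventually_eq hz hev, tendsto_const_nhds.congr' ?_⟩
  filter_upwards [hev, self_mem_nhdsWithin] with t ht ht0
  have ht0' : (t : ℝ) ≠ 0 := ne_of_gt ht0
  rw [ht, hz, ← EReal.coe_sub, ← EReal.coe_sub, ← EReal.coe_div]
  congr 1
  field_simp
  ring

theorem HasDirDeriv.unique {L L' : EReal} (hL : HasDirDeriv h z w L)
    (hL' : HasDirDeriv h z w L') : L = L' :=
  tendsto_nhds_unique hL hL'

theorem HasSecondDirDeriv.unique {q q' : EReal} (hq : HasSecondDirDeriv h z w q)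
    (hq' : HasSecondDirDeriv h z w q') : q = q' := by
  obtain ⟨r, hr, hlim⟩ := hq
  obtain ⟨r', hr', hlim'⟩ := hq'
  obtain rfl : r = r' := EReal.coe_injective (hr.unique hr')
  exact tendsto_nhds_unique hlim hlim'

end DirectionalDerivative

/-- Membership in the cone of directions of non-ascent, without division. -/
theorem mem_nonAscent_iff {n : ℕ} {f : E n → EReal} {x d : E n} {r : ℝ} (hx : f x = (r : EReal)) :
    d ∈ nonAscent f x ↔ ∀ ε : ℝ, 0 < ε → ∃ᶠ p : ℝ × E n in 𝓝[>] (0 : ℝ) ×ˢ 𝓝 d,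
      f (x + p.1 • p.2) ≤ ((r + p.1 * ε : ℝ) : EReal) := by
  have hpos : ∀ᶠ p : ℝ × E n in 𝓝[>] (0 : ℝ) ×ˢ 𝓝 d, 0 < p.1 :=
    tendsto_fst.eventually self_mem_nhdsWithin
  have hiff : ∀ (p : ℝ × E n) (ε : ℝ), 0 < p.1 →
      ((f (x + p.1 • p.2) - f x) / (p.1 : EReal) ≤ (ε : EReal) ↔
        f (x + p.1 • p.2) ≤ ((r + p.1 * ε : ℝ) : EReal)) := by
    intro p ε hp
    rw [EReal.div_le_iff_le_mul (EReal.coe_pos.2 hp) (EReal.coe_ne_top _), hx,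
      EReal.sub_le_iff_le_add (Or.inl (EReal.coe_ne_bot _)) (Or.inl (EReal.coe_ne_top _)),
      ← EReal.coe_mul, ← EReal.coe_add, add_comm (p.1 * ε)]
  constructor
  · intro hd ε hε
    have hlt : liminf (fun p : ℝ × E n => (f (x + p.1 • p.2) - f x) / (p.1 : EReal))
        (𝓝[>] (0 : ℝ) ×ˢ 𝓝 d) < (ε : EReal) := lt_of_le_of_lt hd (EReal.coe_pos.2 hε)
    have := frequently_lt_of_liminf_lt (by isBoundedDefault) hlt
    exact (this.and_eventually hpos).mono fun p hp => (hiff p ε hp.2).1 hp.1.le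
  · intro H
    refine le_of_forall_gt_imp_ge_of_dense (α := EReal) fun b hb => ?_
    obtain ⟨ε, hε, hεb⟩ := EReal.lt_iff_exists_real_btwn.1 hb
    refine le_trans ?_ hεb.le
    refine liminf_le_of_frequently_le' ?_
    exact ((H ε (EReal.coe_pos.1 hε)).and_eventually hpos).mono fun p hp => (hiff p ε hp.2).2 hp.1

/-! ### Taylor expansion of c and the Hessian of the Lagrangian. -/

section Smooth

variable {n m : ℕ} {c : E n → E m}

/-- Second-order Taylor expansion. -/
theorem taylor_two_isLittleO (hc : ContDiff ℝ 2 c) (x : E n) :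
    (fun e => c (x + e) - c x - fderiv ℝ c x e - (1 / 2 : ℝ) • fderiv ℝ (fderiv ℝ c) x e e)
      =o[𝓝 0] fun e => ‖e‖ ^ 2 := by
  have hc1 : Differentiable ℝ c := hc.differentiable two_ne_zero
  have hc2 : DifferentiableAt ℝ (fderiv ℝ c) x :=
    ((hc.fderiv_right (m := 1) (by norm_num)).differentiable one_ne_zero).differentiableAt
  have hsymm : IsSymmSndFDerivAt ℝ c x :=
    hc.contDiffAt.isSymmSndFDerivAt (by simp)
  set B := fderiv ℝ (fderiv ℝ c) x with hB
  set F : E n → E m := fun e => c (x + e) - c x - fderiv ℝ c x e - (1 / 2 : ℝ) • B e e with hF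
  -- Symmetry of the second derivative merges the two terms from differentiating B e e. The
  -- derivative of the remainder is then o(‖e‖), and the mean value inequality on a ball of radius
  -- ‖e‖ gives o(‖e‖²).
  have hderiv : ∀ e, HasFDerivAt F (fderiv ℝ c (x + e) - fderiv ℝ c x - B e) e := by
    intro e
    have h1 : HasFDerivAt (fun e => c (x + e)) (fderiv ℝ c (x + e)) e := by
      exact (hc1 (x + e)).hasFDerivAt.comp e ((hasFDerivAt_id e).const_add x)
    have h2 : HasFDerivAt (fun e => B e e)
        ((B e).comp (ContinuousLinearMap.id ℝ (E n)) + B.flip e) e := by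
      have := B.hasFDerivAt (x := e) |>.clm_apply (hasFDerivAt_id e)
      simpa using this
    have h3 := ((h1.sub_const (c x)).sub (fderiv ℝ c x).hasFDerivAt).sub
      (h2.const_smul (1 / 2 : ℝ))
    refine h3.congr_fderiv ?_
    ext v : 1
    have hv : B v e = B e v := hsymm v e
    simp only [sub_apply, smul_apply, add_apply, ContinuousLinearMap.comp_id, ContinuousLinearMap.flip_apply, hv]
    rw [← two_smul ℝ (B e v), smul_smul]
    norm_num
  rw [Asymptotics.isLittleO_iff]
  intro ε hε
  have hlit := hc2.hasFDerivAt.isLittleO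
  rw [Asymptotics.isLittleO_iff] at hlit
  obtain ⟨ρ, hρ, hball⟩ := Metric.eventually_nhds_iff_ball.1 (hlit hε)
  filter_upwards [Metric.ball_mem_nhds (0 : E n) hρ] with e he
  have hbound : ∀ v ∈ Metric.closedBall (0 : E n) ‖e‖,
      ‖fderiv ℝ c (x + v) - fderiv ℝ c x - B v‖ ≤ ε * ‖e‖ := fun v hv => by
    have hv' : ‖v‖ ≤ ‖e‖ := by simpa using hv
    have := hball (x + v) (by
      simpa using lt_of_le_of_lt hv' (by simpa using he))
    rw [add_sub_cancel_left] at this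
    exact this.trans (mul_le_mul_of_nonneg_left hv' hε.le)
  have hmv := (convex_closedBall (0 : E n) ‖e‖).norm_image_sub_le_of_norm_hasFDerivWithin_le
    (fun v _ => (hderiv v).hasFDerivWithinAt) hbound (x := 0) (y := e) (by simp) (by simp)
  have hF0 : F 0 = 0 := by simp [hF]
  rw [hF0, sub_zero, sub_zero] at hmv
  rw [norm_pow, norm_norm, pow_two, ← mul_assoc]
  exact hmv

theorem gradient_inner_comp (hc : Differentiable ℝ c) (y : E m) :
    gradient (fun u => (inner ℝ y (c u) : ℝ)) = fun u => jacT c u y := by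
  funext u
  refine HasGradientAt.gradient ?_
  rw [hasGradientAt_iff_hasFDerivAt]
  have := ((innerSL ℝ y).hasFDerivAt (x := c u)).comp u (hc u).hasFDerivAt
  refine this.congr_fderiv ?_
  ext v
  simp [jacT, ContinuousLinearMap.adjoint_inner_left]

theorem hasFDerivAt_jacT (hc : ContDiff ℝ 2 c) (y : E m) (x : E n) :
    HasFDerivAt (fun u => jacT c u y) (hessLag c y x) x := by
  have hd : DifferentiableAt ℝ (fun u => jacT c u y) x := by
    have hc2 : DifferentiableAt ℝ (fderiv ℝ c) x :=
      ((hc.fderiv_right (m := 1) (by norm_num)).differentiable one_ne_zero).differentiableAt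
    have : DifferentiableAt ℝ (fun u => jacT c u) x :=
      ((ContinuousLinearMap.adjoint (𝕜 := ℝ) (E := E n)
        (F := E m)).toContinuousLinearEquiv.toContinuousLinearMap.differentiableAt).comp x hc2
    exact this.clm_apply (differentiableAt_const y)
  have := hd.hasFDerivAt
  rwa [hessLag, gradient_inner_comp (hc.differentiable two_ne_zero)]

/-- Differentiate in u the adjoint identity ⟨d, ∇c(u)ᵀy⟩ = ⟨y, ∇c(u)d⟩ in the direction e. -/
theorem inner_hessLag (hc : ContDiff ℝ 2 c) (y : E m) (x d e : E n) :
    (inner ℝ d (hessLag c y x e) : ℝ) = inner ℝ y (fderiv ℝ (fderiv ℝ c) x e d) := by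
  have hc2 : DifferentiableAt ℝ (fderiv ℝ c) x :=
    ((hc.fderiv_right (m := 1) (by norm_num)).differentiable one_ne_zero).differentiableAt
  have h1 : HasFDerivAt (fun u => (inner ℝ d (jacT c u y) : ℝ))
      ((innerSL ℝ d).comp (hessLag c y x)) x :=
    ((innerSL ℝ d).hasFDerivAt).comp x (hasFDerivAt_jacT hc y x)
  have h2 : HasFDerivAt (fun u => (inner ℝ y (fderiv ℝ c u d) : ℝ))
      ((innerSL ℝ y).comp ((fderiv ℝ (fderiv ℝ c) x).flip d)) x := by
    have h3 : HasFDerivAt (fun u => fderiv ℝ c u d) ((fderiv ℝ (fderiv ℝ c) x).flip d) x := by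
      have := hc2.hasFDerivAt.clm_apply (hasFDerivAt_const d x)
      simpa using this
    exact ((innerSL ℝ y).hasFDerivAt).comp x h3
  have h4 : (fun u => (inner ℝ d (jacT c u y) : ℝ)) = fun u => inner ℝ y (fderiv ℝ c u d) := by
    funext u
    rw [jacT, ContinuousLinearMap.adjoint_inner_right, real_inner_comm]
  rw [h4] at h1
  have := DFunLike.congr_fun (h1.unique h2) e
  simpa using this

end Smooth

/-! ### Subdifferentials, conjugates and the KKT mapping. -/

section Subdifferential

variable {m : ℕ} {h : E m → EReal}

theorem mem_subdiff_iff (hprop : IsProper h) {v z : E m} :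
    v ∈ subdiff h z ↔ z ∈ dom h ∧
      ∀ ζ ∈ dom h, (h z).toReal + inner ℝ v (ζ - z) ≤ (h ζ).toReal := by
  constructor
  · rintro ⟨h1, -, h3⟩
    have hz : z ∈ dom h := lt_top_iff_ne_top.2 h1
    refine ⟨hz, fun ζ hζ => ?_⟩
    have := h3 ζ
    rwa [← hprop.coe_toReal hz, ← hprop.coe_toReal hζ, ← EReal.coe_add,
      EReal.coe_le_coe_iff] at this
  · rintro ⟨hz, hle⟩
    refine ⟨ne_of_lt hz, hprop.2 z, fun ζ => ?_⟩
    by_cases hζ : ζ ∈ dom h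
    · rw [← hprop.coe_toReal hz, ← hprop.coe_toReal hζ, ← EReal.coe_add, EReal.coe_le_coe_iff]
      exact hle ζ hζ
    · have : h ζ = ⊤ := not_lt_top_iff.1 hζ
      rw [this]
      exact le_top

theorem le_conjugate (hprop : IsProper h) {z : E m} (hz : z ∈ dom h) (y : E m) :
    ((inner ℝ z y - (h z).toReal : ℝ) : EReal) ≤ conjugate h y := by
  rw [EReal.coe_sub, hprop.coe_toReal hz]
  exact le_iSup (fun z => ((inner ℝ z y : ℝ) : EReal) - h z) z

theorem conjugate_le (hprop : IsProper h) {y : E m} {r : ℝ}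
    (hr : ∀ z ∈ dom h, inner ℝ z y - (h z).toReal ≤ r) : conjugate h y ≤ (r : EReal) := by
  refine iSup_le fun z => ?_
  by_cases hz : z ∈ dom h
  · rw [← hprop.coe_toReal hz, ← EReal.coe_sub, EReal.coe_le_coe_iff]
    exact hr z hz
  · have : h z = ⊤ := not_lt_top_iff.1 hz
    rw [this, EReal.sub_top]
    exact bot_le

/-- The subdifferential of the conjugate is the inverse of the subdifferential, for a proper convex
function with closed epigraph. -/
theorem mem_subdiff_conjugate_iff (hprop : IsProper h) (hconv : IsConvexFun h)
    (hclosed : IsClosed {p : E m × ℝ | h p.1 ≤ (p.2 : EReal)}) {w y : E m} :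
    w ∈ subdiff (conjugate h) y ↔ y ∈ subdiff h w := by
  constructor
  · rintro ⟨h1, h2, h3⟩
    obtain ⟨r, hr⟩ : ∃ r : ℝ, conjugate h y = (r : EReal) :=
      ⟨(conjugate h y).toReal, (EReal.coe_toReal h1 h2).symm⟩
    -- This is the Fenchel inequality in reverse. If it failed, (w, ⟨w, y⟩ - r) could be strictly
    -- separated from the closed convex epigraph.
    have hle : h w ≤ ((inner ℝ w y - r : ℝ) : EReal) := by
      by_contra hcon
      obtain ⟨f, u, hf1, hf2⟩ := geometric_hahn_banach_point_closed
        (x := ((w, inner ℝ w y - r) : E m × ℝ)) hconv hclosed hcon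
      obtain ⟨a, ha⟩ : ∃ a : E m, ∀ v, f (v, 0) = inner ℝ a v := by
        refine ⟨(InnerProductSpace.toDual ℝ (E m)).symm
          (f.comp (ContinuousLinearMap.inl ℝ (E m) ℝ)), fun v => ?_⟩
        simp
      have hf : ∀ v t, f (v, t) = inner ℝ a v + t * f (0, 1) := fun v t => by
        rw [← ha, ← smul_eq_mul, ← map_smul, ← map_add]
        simp
      obtain ⟨z₀, hz₀⟩ := hprop.1
      have hmem : ∀ z ∈ dom h, ∀ t : ℝ, 0 ≤ t →
          u < inner ℝ a z + ((h z).toReal + t) * f (0, 1) := fun z hz t ht => by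
        rw [← hf]
        refine hf2 _ ?_
        change h z ≤ (((h z).toReal + t : ℝ) : EReal)
        rw [hprop.le_coe_iff hz]
        linarith
      rw [hf] at hf1
      have hσ : 0 ≤ f (0, 1) := by
        by_contra hneg
        push Not at hneg
        have h4 := hmem z₀ hz₀ (|(u - inner ℝ a z₀ - (h z₀).toReal * f (0, 1)) / f (0, 1)|)
          (abs_nonneg _)
        have h5 := mul_le_mul_of_nonpos_right
          (le_abs_self ((u - inner ℝ a z₀ - (h z₀).toReal * f (0, 1)) / f (0, 1))) hneg.le
        rw [div_mul_cancel₀ _ hneg.ne] at h5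
        linarith
      -- For a vertical hyperplane the subgradient inequality of the conjugate is tested at y - a;
      -- otherwise it is tested at the slope -σ⁻¹ a of the separating affine function. Both
      -- contradict strict separation.
      rcases hσ.eq_or_lt with hσ | hσ
      · rw [← hσ] at hf1 hmem
        have h4 : conjugate h (y - a) ≤ ((r - u : ℝ) : EReal) := by
          refine conjugate_le hprop fun z hz => ?_
          have h5 := hmem z hz 0 le_rfl
          have h6 := le_conjugate hprop hz y
          rw [hr, EReal.coe_le_coe_iff] at h6
          rw [inner_sub_right, real_inner_comm a z]
          linarith
        have h5 := (h3 (y - a)).trans h4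
        rw [hr, ← EReal.coe_add, EReal.coe_le_coe_iff, sub_sub_cancel_left, inner_neg_right,
          real_inner_comm] at h5
        linarith
      · set σ := f (0, 1)
        have h4 : conjugate h (-σ⁻¹ • a) ≤ ((-(σ⁻¹ * u) : ℝ) : EReal) := by
          refine conjugate_le hprop fun z hz => ?_
          have h5 := hmem z hz 0 le_rfl
          have h6 := mul_le_mul_of_nonneg_left h5.le (inv_pos.2 hσ).le
          have h7 : σ⁻¹ * (inner ℝ a z + ((h z).toReal + 0) * σ) =
              σ⁻¹ * inner ℝ a z + (h z).toReal := by field_simp; ring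
          rw [inner_smul_right, real_inner_comm a z]
          linarith
        have h5 := (h3 (-σ⁻¹ • a)).trans h4
        rw [hr, ← EReal.coe_add, EReal.coe_le_coe_iff, inner_sub_right, inner_smul_right,
          real_inner_comm a w] at h5
        have h6 := mul_lt_mul_of_pos_left hf1 (inv_pos.2 hσ)
        have h7 : σ⁻¹ * (inner ℝ a w + (inner ℝ w y - r) * σ) =
            σ⁻¹ * inner ℝ a w + (inner ℝ w y - r) := by field_simp
        linarith
    have hw : w ∈ dom h := mem_dom_of_le_coe hle
    rw [hprop.le_coe_iff hw] at hle
    refine (mem_subdiff_iff hprop).2 ⟨hw, fun ζ hζ => ?_⟩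
    have h6 := le_conjugate hprop hζ y
    rw [hr, EReal.coe_le_coe_iff] at h6
    rw [inner_sub_right, real_inner_comm ζ y, real_inner_comm w y]
    linarith
  · intro hy
    obtain ⟨hw, hle⟩ := (mem_subdiff_iff hprop).1 hy
    have heq : conjugate h y = ((inner ℝ w y - (h w).toReal : ℝ) : EReal) := by
      refine le_antisymm (conjugate_le hprop fun z hz => ?_) (le_conjugate hprop hw y)
      have := hle z hz
      rw [inner_sub_right, real_inner_comm z y, real_inner_comm w y] at this
      linarith
    refine ⟨by rw [heq]; exact EReal.coe_ne_top _, by rw [heq]; exact EReal.coe_ne_bot _,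
      fun y' => ?_⟩
    have h6 := le_conjugate hprop hw y'
    refine le_trans (le_of_eq ?_) h6
    rw [heq, ← EReal.coe_add, inner_sub_right]
    congr 1
    ring

theorem convex_subdiff (hprop : IsProper h) (z : E m) : Convex ℝ (subdiff h z) := by
  intro u hu v hv a b ha hb hab
  rw [mem_subdiff_iff hprop] at *
  refine ⟨hu.1, fun ζ hζ => ?_⟩
  have h1 := mul_le_mul_of_nonneg_left (hu.2 ζ hζ) ha
  have h2 := mul_le_mul_of_nonneg_left (hv.2 ζ hζ) hb
  rw [inner_add_left, inner_smul_left, inner_smul_left]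
  simp only [RCLike.conj_to_real]
  have h3 : (h z).toReal = a * (h z).toReal + b * (h z).toReal := by rw [← add_mul, hab, one_mul]
  have h4 : (h ζ).toReal = a * (h ζ).toReal + b * (h ζ).toReal := by rw [← add_mul, hab, one_mul]
  linarith

end Subdifferential

/-- Inverting the subdifferential eliminates the conjugate: the second component of w becomes a
shift of the argument c(x) of h. -/
theorem mem_kktMap_iff {n m : ℕ} {h : E m → EReal} {c : E n → E m} (hprop : IsProper h)
    (hconv : IsConvexFun h) (hclosed : IsClosed {p : E m × ℝ | h p.1 ≤ (p.2 : EReal)})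
    {z w : PrimalDual n m} :
    w ∈ kktMap h c z ↔ w.fst = jacT c z.fst z.snd ∧ z.snd ∈ subdiff h (c z.fst + w.snd) := by
  constructor
  · rintro ⟨v, ⟨hv1, hv2⟩, rfl⟩
    rw [mem_subdiff_conjugate_iff hprop hconv hclosed] at hv2
    simpa [kktG, hv1] using hv2
  · rintro ⟨h1, h2⟩
    refine ⟨WithLp.toLp 2 (0, c z.fst + w.snd), ⟨rfl, ?_⟩, ?_⟩
    · rw [mem_subdiff_conjugate_iff hprop hconv hclosed]
      exact h2
    · refine (WithLp.equiv 2 (E n × E m)).injective (Prod.ext ?_ ?_)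
      · simpa [kktG] using h1.symm
      · simp [kktG]

/-! ### Compactness along ultrafilters. -/

/-- This replaces extraction of subsequences: along one fixed ultrafilter all bounded sequences
converge at once. -/
theorem exists_tendsto_of_eventually_norm_le {α V : Type*} [NormedAddCommGroup V] [ProperSpace V]
    (l : Ultrafilter α) {u : α → V} {R : ℝ} (hu : ∀ᶠ a in l, ‖u a‖ ≤ R) :
    ∃ v, Tendsto u l (𝓝 v) := by
  obtain ⟨v, -, hv⟩ := (isCompact_closedBall (0 : V) R).ultrafilter_le_nhds (l.map u)
    (le_principal_iff.2 (by
      change ∀ᶠ a in l, u a ∈ Metric.closedBall (0 : V) R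
      simpa using hu))
  exact ⟨v, hv⟩

theorem tendsto_clm_apply {α V W : Type*} [NormedAddCommGroup V] [NormedSpace ℝ V]
    [NormedAddCommGroup W] [NormedSpace ℝ W] {l : Filter α} {B : α → V →L[ℝ] W} {A : V →L[ℝ] W}
    {u : α → V} {w : V} (hB : Tendsto B l (𝓝 A)) (hu : Tendsto u l (𝓝 w)) :
    Tendsto (fun k => B k (u k)) l (𝓝 (A w)) :=
  (isBoundedBilinearMap_apply.continuous.tendsto (A, w)).comp (hB.prodMk_nhds hu)

/-! ### Metric regularity from the constraint qualification. -/

/-- The residual at a nearest point is a normal vector. -/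
theorem sub_mem_normalCone_of_infDist_eq {m : ℕ} {D : Set (E m)} (hD : Convex ℝ D) {u p : E m}
    (hp : p ∈ D) (hdist : Metric.infDist u D = dist u p) : u - p ∈ normalCone D p := by
  rw [Metric.infDist_eq_iInf, dist_eq_norm] at hdist
  simp only [dist_eq_norm] at hdist
  exact (norm_eq_iInf_iff_real_inner_le_zero hD hp).1 hdist.symm

theorem smul_mem_normalCone {m : ℕ} {D : Set (E m)} {p v : E m} (hv : v ∈ normalCone D p) {t : ℝ}
    (ht : 0 ≤ t) : t • v ∈ normalCone D p := fun z hz => by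
  rw [inner_smul_left]
  exact mul_nonpos_of_nonneg_of_nonpos ht (hv z hz)

section Regularity

variable {n m : ℕ} {c : E n → E m} {D : Set (E m)} {xbar : E n}

theorem continuous_jacT (hc : ContDiff ℝ 1 c) : Continuous fun u => jacT c u :=
  (ContinuousLinearMap.adjoint (𝕜 := ℝ) (E := E n) (F := E m)).continuous.comp
    (hc.continuous_fderiv one_ne_zero)

theorem tendsto_jacT_apply (hc : ContDiff ℝ 1 c) {α : Type*} {l : Filter α} {x : α → E n}
    {u : α → E m} {w : E m} (hx : Tendsto x l (𝓝 xbar)) (hu : Tendsto u l (𝓝 w)) :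
    Tendsto (fun k => jacT c (x k) (u k)) l (𝓝 (jacT c xbar w)) := by
  have h1 : Tendsto (fun k => jacT c (x k)) l (𝓝 (jacT c xbar)) :=
    ((continuous_jacT hc).tendsto xbar).comp hx
  exact tendsto_clm_apply h1 hu

/-- Under the basic constraint qualification, the transposed Jacobian is uniformly injective on
normal cones near the base point. -/
theorem exists_norm_le_norm_jacT (hc : ContDiff ℝ 1 c)
    (hB : {y | jacT c xbar y = 0} ∩ normalCone D (c xbar) = {0}) :
    ∃ δ : ℝ, 0 < δ ∧ ∀ x ∈ Metric.ball xbar δ, ∀ p ∈ Metric.ball (c xbar) δ,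
      ∀ v ∈ normalCone D p, δ * ‖v‖ ≤ ‖jacT c x v‖ := by
  by_contra hcon
  push Not at hcon
  have hpos : ∀ k : ℕ, (0 : ℝ) < 1 / ((k : ℝ) + 1) := fun k => Nat.one_div_pos_of_nat
  choose x hx p hp v hv hlt using fun k : ℕ => hcon _ (hpos k)
  have hv0 : ∀ k, 0 < ‖v k‖ := fun k => by
    refine norm_pos_iff.2 fun h0 => ?_
    have := hlt k
    simp [h0] at this
  -- Normalized counterexamples converge to a unit vector that lies in the null space and, since
  -- normal vectors survive limits, in the normal cone at c(xbar).
  obtain ⟨u, hu⟩ : ∃ u : ℕ → E m, ∀ k, u k = ‖v k‖⁻¹ • v k := ⟨_, fun _ => rfl⟩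
  have hun : ∀ k, ‖u k‖ = 1 := fun k => by
    rw [hu, norm_smul, norm_inv, norm_norm, inv_mul_cancel₀ (hv0 k).ne']
  obtain ⟨w, hw⟩ := exists_tendsto_of_eventually_norm_le (hyperfilter ℕ) (u := u) (R := 1)
    (Eventually.of_forall fun k => (hun k).le)
  have hlim : Tendsto (fun k : ℕ => 1 / ((k : ℝ) + 1)) (hyperfilter ℕ) (𝓝 0) :=
    tendsto_one_div_add_atTop_nhds_zero_nat.mono_left Nat.hyperfilter_le_atTop
  have hxl : Tendsto x (hyperfilter ℕ) (𝓝 xbar) :=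
    tendsto_iff_dist_tendsto_zero.2 (squeeze_zero (fun _ => dist_nonneg)
      (fun k => (Metric.mem_ball.1 (hx k)).le) hlim)
  have hpl : Tendsto p (hyperfilter ℕ) (𝓝 (c xbar)) :=
    tendsto_iff_dist_tendsto_zero.2 (squeeze_zero (fun _ => dist_nonneg)
      (fun k => (Metric.mem_ball.1 (hp k)).le) hlim)
  have hjac : jacT c xbar w = 0 := by
    have h1 : Tendsto (fun k => jacT c (x k) (u k)) (hyperfilter ℕ) (𝓝 (jacT c xbar w)) :=
      tendsto_jacT_apply hc hxl hw
    have h2 : Tendsto (fun k => jacT c (x k) (u k)) (hyperfilter ℕ) (𝓝 0) := by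
      refine squeeze_zero_norm (fun k => ?_) hlim
      rw [hu]
      rw [map_smul, norm_smul, norm_inv, norm_norm, inv_mul_le_iff₀ (hv0 k), mul_comm]
      exact (hlt k).le
    exact tendsto_nhds_unique h1 h2
  have hnorm : w ∈ normalCone D (c xbar) := fun z hz => by
    have h1 : Tendsto (fun k => (inner ℝ (u k) (z - p k) : ℝ)) (hyperfilter ℕ)
        (𝓝 (inner ℝ w (z - c xbar))) := hw.inner (tendsto_const_nhds.sub hpl)
    exact le_of_tendsto' h1 fun k => by
      rw [hu]
      exact smul_mem_normalCone (hv k) (inv_pos.2 (hv0 k)).le z hz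
  have hw0 : w = 0 := by
    have : w ∈ {y | jacT c xbar y = 0} ∩ normalCone D (c xbar) := ⟨hjac, hnorm⟩
    rw [hB] at this
    exact this
  have h1 : ‖w‖ = 1 := tendsto_nhds_unique hw.norm (by simp [hun])
  simp [hw0] at h1

/-- At a local minimizer of `δ ‖u - x‖ + dist (c u) D`, the constraint `c u ∈ D` holds provided
the transposed Jacobian is bounded below by `2 δ` on the residual. -/
theorem mem_of_isLocalMin_dist (hc : Differentiable ℝ c) {x x' : E n} {p : E m} {δ : ℝ}
    (hδ : 0 < δ) (hp : p ∈ D)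
    (hdist : Metric.infDist (c x') D = dist (c x') p)
    (hmin : IsLocalMin (fun u => δ * ‖u - x‖ + Metric.infDist (c u) D) x')
    (hjac : 2 * δ * ‖c x' - p‖ ≤ ‖jacT c x' (c x' - p)‖) : c x' ∈ D := by
  by_contra hnot
  set v := c x' - p with hv
  have hv0 : 0 < ‖v‖ := norm_pos_iff.2 fun h0 => hnot (by rwa [sub_eq_zero.1 h0])
  set q := jacT c x' v with hq
  have hq0 : 0 < ‖q‖ := lt_of_lt_of_le (by positivity) hjac
  -- With the nearest point p frozen, ψ is differentiable, majorizes the objective along the ray x'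
  -- - s q up to the constant δ‖x' - x‖, and is exact at s = 0. Minimality gives ψ'(0) ≥ 0, hence
  -- ‖q‖ ≤ δ‖v‖, against the factor 2 in the hypothesis.
  set ψ : ℝ → ℝ := fun s => δ * s * ‖q‖ + ‖c (x' - s • q) - p‖ with hψ
  have hline : HasDerivAt (fun s : ℝ => x' - s • q) (-q) 0 := by
    simpa using ((hasDerivAt_id (0 : ℝ)).smul_const q).const_sub x'
  have hcomp : HasDerivAt (fun s : ℝ => c (x' - s • q) - p) (fderiv ℝ c x' (-q)) 0 := by
    have h1 : HasFDerivAt c (fderiv ℝ c x') (x' - (0 : ℝ) • q) := by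
      simpa using (hc x').hasFDerivAt
    exact (h1.comp_hasDerivAt (0 : ℝ) hline).sub_const p
  have hderiv : HasDerivAt ψ (δ * ‖q‖ - ‖q‖ ^ 2 / ‖v‖) 0 := by
    have h1 := hcomp.norm_sq.sqrt (by simpa [← hv] using hv0.ne')
    have h2 := (((hasDerivAt_id (0 : ℝ)).const_mul δ).mul_const ‖q‖).add h1
    have h3 : (inner ℝ v (fderiv ℝ c x' q) : ℝ) = ‖q‖ ^ 2 := by
      rw [← ContinuousLinearMap.adjoint_inner_left]
      exact real_inner_self_eq_norm_sq q
    refine (h2.congr_deriv ?_).congr_of_eventuallyEq (Eventually.of_forall fun s => ?_)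
    · simp only [zero_smul, sub_zero, ← hv, map_neg, inner_neg_right, h3,
        Real.sqrt_sq (norm_nonneg v)]
      field_simp
      ring
    · simp [hψ, Real.sqrt_sq (norm_nonneg _)]
  have hge : ∀ᶠ s in 𝓝[>] (0 : ℝ), ψ 0 ≤ ψ s := by
    have hcont : Tendsto (fun s : ℝ => x' - s • q) (𝓝[>] 0) (𝓝 x') := by
      simpa using hline.continuousAt.tendsto.mono_left nhdsWithin_le_nhds
    filter_upwards [hcont.eventually hmin, self_mem_nhdsWithin] with s hs hs0
    have hs0' : (0 : ℝ) < s := hs0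
    have h1 : ‖x' - s • q - x‖ ≤ ‖x' - x‖ + s * ‖q‖ := by
      have h2 : x' - s • q - x = (x' - x) - s • q := by abel
      rw [h2]
      refine (norm_sub_le _ _).trans ?_
      rw [norm_smul, Real.norm_of_nonneg hs0'.le]
    have h3 : Metric.infDist (c (x' - s • q)) D ≤ ‖c (x' - s • q) - p‖ := by
      rw [← dist_eq_norm]
      exact Metric.infDist_le_dist_of_mem hp
    have h4 := mul_le_mul_of_nonneg_left h1 hδ.le
    rw [hdist, dist_eq_norm, ← hv] at hs
    have h5 : ψ 0 = ‖v‖ := by simp [hψ, ← hv]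
    rw [h5]
    simp only [hψ]
    linarith
  have hslope := hderiv.tendsto_slope_zero_right
  have h0 : 0 ≤ δ * ‖q‖ - ‖q‖ ^ 2 / ‖v‖ := by
    refine ge_of_tendsto hslope ?_
    filter_upwards [hge, self_mem_nhdsWithin] with s hs hs0
    rw [zero_add, smul_eq_mul]
    exact mul_nonneg (inv_pos.2 hs0).le (sub_nonneg.2 hs)
  have h6 : ‖q‖ ^ 2 ≤ δ * ‖q‖ * ‖v‖ := by
    rw [sub_nonneg, div_le_iff₀ hv0] at h0
    exact h0
  have h7 : ‖q‖ ≤ δ * ‖v‖ := by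
    refine le_of_mul_le_mul_right ?_ hq0
    nlinarith
  have h8 : 0 < δ * ‖v‖ := mul_pos hδ hv0
  linarith

/-- Metric regularity of the constraint system `c x ∈ D` under the basic constraint
qualification. -/
theorem exists_feasible_of_constraint_qualification (hc : ContDiff ℝ 1 c) (hclosed : IsClosed D)
    (hconv : Convex ℝ D) (hx : c xbar ∈ D)
    (hB : {y | jacT c xbar y = 0} ∩ normalCone D (c xbar) = {0}) :
    ∃ κ : ℝ, 0 < κ ∧ ∀ᶠ p : E n × E m in 𝓝 (xbar, c xbar), p.2 ∈ D →
      ∃ x', c x' ∈ D ∧ ‖x' - p.1‖ ≤ κ * ‖p.2 - c p.1‖ := by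
  obtain ⟨δ, hδ, htrans⟩ := exists_norm_le_norm_jacT hc hB
  have hdiff : Differentiable ℝ c := hc.differentiable one_ne_zero
  obtain ⟨ρ, hρ, hρc⟩ : ∃ ρ : ℝ, 0 < ρ ∧ ∀ x ∈ Metric.ball xbar ρ,
      x ∈ Metric.ball xbar δ ∧ c x ∈ Metric.ball (c xbar) (δ / 2) :=
    Metric.eventually_nhds_iff_ball.1 (Filter.Eventually.and (Metric.ball_mem_nhds xbar hδ)
      ((hdiff.continuous.tendsto xbar).eventually (Metric.ball_mem_nhds _ (half_pos hδ))))
  -- The penalty weight is δ/2: a minimizer moves at most (2/δ)‖z - c(x)‖, and twice the weight is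
  -- exactly the injectivity constant δ.
  refine ⟨2 / δ, by positivity, ?_⟩
  have hsmall : ∀ᶠ p : E n × E m in 𝓝 (xbar, c xbar),
      ‖p.1 - xbar‖ + 2 / δ * ‖p.2 - c p.1‖ < ρ / 2 := by
    have hcont : Continuous fun p : E n × E m => ‖p.1 - xbar‖ + 2 / δ * ‖p.2 - c p.1‖ := by
      have := hdiff.continuous
      fun_prop
    exact (hcont.tendsto (xbar, c xbar)).eventually_lt_const (by simpa using half_pos hρ)
  filter_upwards [hsmall] with ⟨x, z⟩ hxz hzD
  simp only at hxz hzD ⊢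
  have hκ : 0 ≤ 2 / δ * ‖z - c x‖ := by positivity
  have hxball : x ∈ Metric.closedBall xbar (ρ / 2) := by
    rw [mem_closedBall_iff_norm]
    linarith
  have hφcont : Continuous fun u => δ / 2 * ‖u - x‖ + Metric.infDist (c u) D := by
    have h1 := hdiff.continuous
    have h2 := Metric.continuous_infDist_pt D
    fun_prop
  -- A minimizer exists on the compact ball; the smallness of (x, z) keeps it in the interior, so it
  -- is a local minimizer.
  obtain ⟨x', hx'ball, hx'min⟩ := (isCompact_closedBall xbar (ρ / 2)).exists_isMinOn
    ⟨x, hxball⟩ hφcont.continuousOn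
  have hle : δ / 2 * ‖x' - x‖ + Metric.infDist (c x') D ≤ ‖z - c x‖ := by
    have h1 := hx'min hxball
    simp only [Set.mem_ofPred_eq, sub_self, norm_zero, mul_zero, zero_add] at h1
    refine h1.trans ?_
    rw [norm_sub_rev, ← dist_eq_norm]
    exact Metric.infDist_le_dist_of_mem hzD
  have hle' : ‖x' - x‖ ≤ 2 / δ * ‖z - c x‖ := by
    have h1 : δ / 2 * ‖x' - x‖ ≤ ‖z - c x‖ := by
      linarith [Metric.infDist_nonneg (x := c x') (s := D)]
    rw [div_mul_eq_mul_div, le_div_iff₀ hδ]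
    linarith
  have hx'lt : ‖x' - xbar‖ < ρ / 2 := by
    have := norm_sub_le_norm_sub_add_norm_sub x' x xbar
    linarith
  refine ⟨x', ?_, hle'⟩
  have hlocal : IsLocalMin (fun u => δ / 2 * ‖u - x‖ + Metric.infDist (c u) D) x' :=
    hx'min.isLocalMin (mem_of_superset
      (Metric.isOpen_ball.mem_nhds (mem_ball_iff_norm.2 hx'lt)) Metric.ball_subset_closedBall)
  obtain ⟨p, hpD, hp⟩ := hclosed.exists_infDist_eq_dist ⟨_, hx⟩ (c x')
  obtain ⟨hx'δ, hcx'⟩ := hρc x' (mem_ball_iff_norm.2 (by linarith))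
  have hpball : p ∈ Metric.ball (c xbar) δ := by
    have h1 : dist (c x') p ≤ dist (c x') (c xbar) := by
      rw [← hp]
      exact Metric.infDist_le_dist_of_mem hx
    have h2 := dist_triangle_left p (c xbar) (c x')
    rw [Metric.mem_ball] at hcx' ⊢
    linarith
  refine mem_of_isLocalMin_dist hdiff (half_pos hδ) hpD hp hlocal ?_
  have := htrans x' hx'δ p hpball _ (sub_mem_normalCone_of_infDist_eq hconv hpD hp)
  linarith

/-- Under the basic constraint qualification, a pair `(x, z)` with `z ∈ dom h` can be corrected to
a point `x'` feasible for `h ∘ c`, with error controlled by `‖z - c x‖`. -/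
theorem exists_feasible_value_le {h : E m → EReal} (hPLQ : IsPLQ h) (hconv : IsConvexFun h)
    (hc : ContDiff ℝ 1 c) (hx : c xbar ∈ dom h) (hB : BCQ h c xbar) :
    ∃ κ : ℝ, 0 < κ ∧ ∀ᶠ p : E n × E m in 𝓝 (xbar, c xbar), p.2 ∈ dom h →
      ∃ x', ‖x' - p.1‖ ≤ κ * ‖p.2 - c p.1‖ ∧ c x' ∈ dom h ∧
        (h (c x')).toReal ≤ (h p.2).toReal + κ * ‖p.2 - c p.1‖ := by
  obtain ⟨κ, hκ, hreg⟩ := exists_feasible_of_constraint_qualification hc hPLQ.isClosed_dom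
    (hconv.convexOn hPLQ.1).1 hx hB
  obtain ⟨L, hL, r, hr, hLip⟩ := hPLQ.exists_lipschitz hconv (c xbar)
  obtain ⟨Lc, U, hU, hLc⟩ := hc.contDiffAt.exists_lipschitzOnWith (𝕂 := ℝ) (x := xbar)
  obtain ⟨ρ, hρ, hρU⟩ : ∃ ρ : ℝ, 0 < ρ ∧ ∀ x ∈ Metric.ball xbar ρ,
      x ∈ U ∧ c x ∈ Metric.ball (c xbar) r :=
    Metric.eventually_nhds_iff_ball.1 (Filter.Eventually.and hU
      ((hc.continuous.tendsto xbar).eventually (Metric.ball_mem_nhds _ hr)))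
  have hsmall : ∀ᶠ p : E n × E m in 𝓝 (xbar, c xbar),
      ‖p.1 - xbar‖ + κ * ‖p.2 - c p.1‖ < ρ := by
    have hcont : Continuous fun p : E n × E m => ‖p.1 - xbar‖ + κ * ‖p.2 - c p.1‖ := by
      have := hc.continuous
      fun_prop
    exact (hcont.tendsto (xbar, c xbar)).eventually_lt_const (by simpa using hρ)
  have hz : ∀ᶠ p : E n × E m in 𝓝 (xbar, c xbar), p.2 ∈ Metric.ball (c xbar) r :=
    (continuous_snd.tendsto (xbar, c xbar)).eventually (Metric.ball_mem_nhds _ hr)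
  -- The second constant comes from ‖c(x') - z‖ ≤ ‖c(x') - c(x)‖ + ‖c(x) - z‖ ≤ (Lc κ + 1)‖z - c(x)‖
  -- and the Lipschitz constant L of h.
  refine ⟨max κ (L * (Lc * κ + 1)), lt_max_of_lt_left hκ, ?_⟩
  filter_upwards [hreg, hsmall, hz] with ⟨x, z⟩ h1 h2 h3 hzD
  simp only at h1 h2 h3 hzD ⊢
  obtain ⟨x', hx'D, hx'⟩ := h1 hzD
  have hκ0 : 0 ≤ κ * ‖z - c x‖ := by positivity
  have hxρ : x ∈ Metric.ball xbar ρ := mem_ball_iff_norm.2 (by linarith)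
  have hx'ρ : x' ∈ Metric.ball xbar ρ := mem_ball_iff_norm.2 (by
    linarith [norm_sub_le_norm_sub_add_norm_sub x' x xbar])
  refine ⟨x', hx'.trans (mul_le_mul_of_nonneg_right (le_max_left _ _) (norm_nonneg _)), hx'D, ?_⟩
  refine (hLip z ⟨h3, hzD⟩ (c x') ⟨(hρU x' hx'ρ).2, hx'D⟩).trans ?_
  have h4 : ‖c x' - c x‖ ≤ Lc * ‖x' - x‖ := by
    have := hLc.dist_le_mul x' (hρU x' hx'ρ).1 x (hρU x hxρ).1
    rwa [dist_eq_norm, dist_eq_norm] at this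
  have h5 : ‖c x' - z‖ ≤ (Lc * κ + 1) * ‖z - c x‖ := by
    have h6 := norm_sub_le_norm_sub_add_norm_sub (c x') (c x) z
    rw [norm_sub_rev (c x) z] at h6
    have h7 := mul_le_mul_of_nonneg_left hx' Lc.2
    simp only [NNReal.val_eq_coe] at h7
    linarith
  have h8 := mul_le_mul_of_nonneg_left h5 hL
  have h9 := mul_le_mul_of_nonneg_right (le_max_right κ (L * (Lc * κ + 1))) (norm_nonneg (z - c x))
  linarith

end Regularity

/-! ### Calculus in the local model. -/

theorem le_of_eventually_le_add_mul {a b r : ℝ} (H : ∀ᶠ t in 𝓝[>] (0 : ℝ), a ≤ b + t * r) :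
    a ≤ b := by
  have hcont : Continuous fun t : ℝ => b + t * r := by fun_prop
  have hlim : Tendsto (fun t : ℝ => b + t * r) (𝓝[>] 0) (𝓝 b) := by
    simpa using (hcont.tendsto 0).mono_left nhdsWithin_le_nhds
  exact ge_of_tendsto hlim H

namespace LocalModel

variable {m : ℕ} {h : E m → EReal} {z : E m} (M : LocalModel h z)

/-- The cones of a local model. -/
def cone (k : M.ι) : Set (E m) := {w | ∀ j, inner ℝ (M.a k j) w ≤ 0}

theorem isClosed_cone (k : M.ι) : IsClosed (M.cone k) := by
  simp only [cone, Set.ofPred_forall]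
  exact isClosed_iInter fun j => isClosed_le (by fun_prop) continuous_const

theorem smul_mem_cone {k : M.ι} {w : E m} (hw : w ∈ M.cone k) {t : ℝ} (ht : 0 ≤ t) :
    t • w ∈ M.cone k := fun j => by
  rw [inner_smul_right]
  exact mul_nonpos_of_nonneg_of_nonpos ht (hw j)

theorem smul_mem_cone_iff {k : M.ι} {w : E m} {t : ℝ} (ht : 0 < t) :
    t • w ∈ M.cone k ↔ w ∈ M.cone k := by
  refine ⟨fun hw => ?_, fun hw => M.smul_mem_cone hw ht.le⟩
  have := M.smul_mem_cone hw (inv_pos.2 ht).le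
  rwa [smul_smul, inv_mul_cancel₀ ht.ne', one_smul] at this

theorem continuous_Q (k : M.ι) : Continuous (M.Q k) :=
  (M.Q k).continuous_of_finiteDimensional

variable {M}

theorem eventually_eq {k : M.ι} {w : E m} (hw : w ∈ M.cone k) :
    ∀ᶠ t in 𝓝[>] (0 : ℝ), h (z + t • w) = (((h z).toReal + t * inner ℝ (M.g k) w +
      t ^ 2 / 2 * inner ℝ w (M.Q k w) : ℝ) : EReal) := by
  obtain ⟨ε, hε, hal⟩ := M.along k w hw
  filter_upwards [Ioc_mem_nhdsGT hε] with t ht using hal t ht.1.le ht.2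

theorem hasDirDeriv (hprop : IsProper h) (hz : z ∈ dom h) {k : M.ι} {w : E m}
    (hw : w ∈ M.cone k) : HasDirDeriv h z w ((inner ℝ (M.g k) w : ℝ) : EReal) :=
  hasDirDeriv_of_eventually_eq (hprop.coe_toReal hz).symm (eventually_eq hw)

theorem hasSecondDirDeriv (hprop : IsProper h) (hz : z ∈ dom h) {k : M.ι} {w : E m}
    (hw : w ∈ M.cone k) : HasSecondDirDeriv h z w ((inner ℝ w (M.Q k w) : ℝ) : EReal) :=
  hasSecondDirDeriv_of_eventually_eq (hprop.coe_toReal hz).symm (eventually_eq hw)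

theorem inner_le (hprop : IsProper h) {v : E m} (hv : v ∈ subdiff h z) {k : M.ι} {w : E m}
    (hw : w ∈ M.cone k) : inner ℝ v w ≤ inner ℝ (M.g k) w := by
  refine le_of_eventually_le_add_mul (r := inner ℝ w (M.Q k w) / 2) ?_
  filter_upwards [eventually_eq hw, self_mem_nhdsWithin] with t ht ht0
  have ht0' : (0 : ℝ) < t := ht0
  have h1 := ((mem_subdiff_iff hprop).1 hv).2 _ (mem_dom_of_eq_coe ht)
  rw [ht, EReal.toReal_coe, add_sub_cancel_left, inner_smul_right] at h1
  refine le_of_mul_le_mul_left ?_ ht0'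
  linarith

/-- Local data suffice by convexity: any ζ in the domain is pulled towards z until it falls in a
cone, and the directional derivative at z is at most the chord slope. -/
theorem mem_subdiff_of_inner_le (hprop : IsProper h) (hconv : IsConvexFun h) (hz : z ∈ dom h)
    {v : E m} (hv : ∀ k, ∀ w ∈ M.cone k, inner ℝ v w ≤ inner ℝ (M.g k) w) : v ∈ subdiff h z := by
  refine (mem_subdiff_iff hprop).2 ⟨hz, fun ζ hζ => ?_⟩
  have hcv := hconv.convexOn hprop
  have hlim : Tendsto (fun t : ℝ => z + t • (ζ - z)) (𝓝[>] 0) (𝓝 z) := by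
    have hcont : Continuous fun t : ℝ => z + t • (ζ - z) := by fun_prop
    simpa using (hcont.tendsto 0).mono_left nhdsWithin_le_nhds
  obtain ⟨τ, hnear, hτ⟩ :=
    ((hlim.eventually M.near).and (Ioc_mem_nhdsGT (zero_lt_one' ℝ))).exists
  have hτ0 : 0 < τ := hτ.1
  obtain ⟨k, hk, hform⟩ := hnear (hcv.1.add_smul_sub_mem hz hζ ⟨hτ0.le, hτ.2⟩)
  rw [add_sub_cancel_left] at hk hform
  have hkc : ζ - z ∈ M.cone k := (M.smul_mem_cone_iff hτ0).1 hk
  have h1 := hv k _ hkc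
  have h2 : inner ℝ (M.g k) (ζ - z) ≤ (h ζ).toReal - (h z).toReal := by
    refine le_of_eventually_le_add_mul (r := -(inner ℝ (ζ - z) (M.Q k (ζ - z)) / 2)) ?_
    filter_upwards [eventually_eq hkc, Ioc_mem_nhdsGT (zero_lt_one' ℝ)] with t ht ht0
    have ht0' : (0 : ℝ) < t := ht0.1
    have h3 := hcv.2 hz hζ (sub_nonneg.2 ht0.2) ht0.1.le (sub_add_cancel 1 t)
    have h4 : (1 - t) • z + t • ζ = z + t • (ζ - z) := by module
    simp only [h4, ht, EReal.toReal_coe, smul_eq_mul] at h3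
    refine le_of_mul_le_mul_left ?_ ht0'
    linarith
  linarith

/-- Along an ultrafilter, points of the domain converging to `z` stay in one piece. -/
theorem exists_piece {α : Type*} (l : Ultrafilter α) {t : α → ℝ} {w : α → E m} {w₀ : E m}
    (ht : Tendsto t l (𝓝 0)) (ht0 : ∀ᶠ i in l, 0 < t i) (hw : Tendsto w l (𝓝 w₀))
    (hdom : ∀ᶠ i in l, z + t i • w i ∈ dom h) :
    ∃ k, w₀ ∈ M.cone k ∧ ∀ᶠ i in l, w i ∈ M.cone k ∧ ∀ s : ℝ, 0 ≤ s → s ≤ t i →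
      h (z + s • w i) = (((h z).toReal + s * inner ℝ (M.g k) (w i) +
        s ^ 2 / 2 * inner ℝ (w i) (M.Q k (w i)) : ℝ) : EReal) := by
  have := M.fin
  have hlim : Tendsto (fun i => z + t i • w i) l (𝓝 z) := by
    simpa using tendsto_const_nhds.add (ht.smul hw)
  have hex : ∀ᶠ i in l, ∃ k, w i ∈ M.cone k ∧ ∀ s : ℝ, 0 ≤ s → s ≤ t i →
      h (z + s • w i) = (((h z).toReal + s * inner ℝ (M.g k) (w i) +
        s ^ 2 / 2 * inner ℝ (w i) (M.Q k (w i)) : ℝ) : EReal) := by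
    filter_upwards [hlim.eventually M.near, hdom, ht0] with i hnear hd hti
    obtain ⟨k, hk, hform⟩ := hnear hd
    rw [add_sub_cancel_left] at hk hform
    refine ⟨k, (M.smul_mem_cone_iff hti).1 hk, fun s hs0 hst => ?_⟩
    have := hform (s / t i) (div_nonneg hs0 hti.le) ((div_le_one hti).2 hst)
    rw [smul_smul, div_mul_cancel₀ _ hti.ne', map_smul, inner_smul_left, inner_smul_right,
      inner_smul_right] at this
    rw [this]
    congr 1
    simp only [RCLike.conj_to_real]
    field_simp
  -- An ultrafilter selects one of finitely many alternatives, so no further subsequence is needed.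
  obtain ⟨k, hk⟩ := Ultrafilter.eventually_exists_iff.1 hex
  exact ⟨k, (M.isClosed_cone k).mem_of_tendsto hw (hk.mono fun i hi => hi.1), hk⟩

end LocalModel

/-! ### Difference quotients along converging directions. -/

section Expansions

variable {n m : ℕ} {c : E n → E m} {α : Type*} {l : Filter α} {t : α → ℝ} {d : α → E n} {d₀ : E n}

theorem tendsto_difference_quotient {V W : Type*} [NormedAddCommGroup V] [NormedSpace ℝ V]
    [NormedAddCommGroup W] [NormedSpace ℝ W] {F : V → W} {F' : V →L[ℝ] W} {x : V}
    (hF : HasFDerivAt F F' x) {d : α → V} {d₀ : V} (ht : Tendsto t l (𝓝 0))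
    (ht0 : ∀ᶠ i in l, 0 < t i) (hd : Tendsto d l (𝓝 d₀)) :
    Tendsto (fun i => (t i)⁻¹ • (F (x + t i • d i) - F x)) l (𝓝 (F' d₀)) := by
  have h1 := (hasFDerivAt_iff_isLittleO_nhds_zero.1 hF)
  have htd : Tendsto (fun i => t i • d i) l (𝓝 0) := by simpa using ht.smul hd
  have h2 := h1.comp_tendsto htd
  have h3 : (fun i => t i • d i) =O[l] t := by
    simpa using (Asymptotics.isBigO_refl t l).smul (hd.isBigO_one ℝ)
  have h4 := (h2.trans_isBigO h3).tendsto_inv_smul_nhds_zero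
  have h5 : Tendsto (fun i => F' (d i)) l (𝓝 (F' d₀)) := (F'.continuous.tendsto d₀).comp hd
  have h6 := h4.add h5
  rw [zero_add] at h6
  refine h6.congr' ?_
  filter_upwards [ht0] with i hi
  simp only [Function.comp_apply, map_smul, smul_sub, smul_smul, inv_mul_cancel₀ hi.ne', one_smul]
  abel

/-- Second-order difference quotients of a twice continuously differentiable map. -/
theorem tendsto_second_difference_quotient (hc : ContDiff ℝ 2 c) (x : E n)
    (ht : Tendsto t l (𝓝 0)) (ht0 : ∀ᶠ i in l, 0 < t i) (hd : Tendsto d l (𝓝 d₀)) :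
    Tendsto (fun i => (t i ^ 2)⁻¹ • (c (x + t i • d i) - c x - t i • fderiv ℝ c x (d i))) l
      (𝓝 ((1 / 2 : ℝ) • fderiv ℝ (fderiv ℝ c) x d₀ d₀)) := by
  set B := fderiv ℝ (fderiv ℝ c) x
  have htd : Tendsto (fun i => t i • d i) l (𝓝 0) := by simpa using ht.smul hd
  have h2 := (taylor_two_isLittleO hc x).comp_tendsto htd
  have h3 : (fun i => t i • d i) =O[l] t := by
    simpa using (Asymptotics.isBigO_refl t l).smul (hd.isBigO_one ℝ)
  have h4 := (h2.trans_isBigO (h3.norm_left.pow 2)).tendsto_inv_smul_nhds_zero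
  have h5 : Tendsto (fun i => (1 / 2 : ℝ) • B (d i) (d i)) l (𝓝 ((1 / 2 : ℝ) • B d₀ d₀)) :=
    (tendsto_clm_apply ((B.continuous.tendsto d₀).comp hd) hd).const_smul _
  have h6 := h4.add h5
  rw [zero_add] at h6
  refine h6.congr' ?_
  filter_upwards [ht0] with i hi
  have h7 : B (t i • d i) (t i • d i) = (t i ^ 2) • B (d i) (d i) := by
    simp only [map_smul, smul_apply, smul_smul, pow_two]
  have h8 : (t i ^ 2)⁻¹ • (1 / 2 : ℝ) • (t i ^ 2) • B (d i) (d i) =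
      (1 / 2 : ℝ) • B (d i) (d i) := by
    rw [smul_comm, inv_smul_smul₀ (pow_pos hi 2).ne']
  simp only [Function.comp_apply]
  rw [smul_sub, h7, h8, map_smul, sub_add_cancel]

end Expansions

/-! ### Directions of non-ascent. -/

section Ascent

variable {n m : ℕ} {h : E m → EReal} {c : E n → E m} {xbar d : E n}

theorem mem_nonAscent_of_tendsto {f : E n → EReal} {r : ℝ} (hx : f xbar = (r : EReal))
    {α : Type*} {l : Filter α} [l.NeBot] {t : α → ℝ} {d' : α → E n} {η : α → ℝ}
    (ht : Tendsto t l (𝓝 0)) (ht0 : ∀ᶠ i in l, 0 < t i) (hd : Tendsto d' l (𝓝 d))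
    (hη : Tendsto η l (𝓝 0))
    (hle : ∀ᶠ i in l, f (xbar + t i • d' i) ≤ ((r + t i * η i : ℝ) : EReal)) :
    d ∈ nonAscent f xbar := by
  refine (mem_nonAscent_iff hx).2 fun ε hε => ?_
  have hpair : Tendsto (fun i => (t i, d' i)) l (𝓝[>] (0 : ℝ) ×ˢ 𝓝 d) :=
    (tendsto_nhdsWithin_iff.2 ⟨ht, ht0⟩).prodMk hd
  refine hpair.frequently (Eventually.frequently ?_)
  filter_upwards [hle, ht0, hη.eventually_le_const hε] with i h1 h2 h3
  refine h1.trans (EReal.coe_le_coe_iff.2 ?_)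
  linarith [mul_le_mul_of_nonneg_left h3 h2.le]

/-- The subderivative of `h ∘ c` is bounded above by the directional derivative of `h`, under the
basic constraint qualification. -/
theorem mem_nonAscent_of_inner_nonpos (hPLQ : IsPLQ h) (hconv : IsConvexFun h)
    (hc : ContDiff ℝ 1 c) (hx : c xbar ∈ dom h) (hB : BCQ h c xbar) (M : LocalModel h (c xbar))
    {k : M.ι} (hk : fderiv ℝ c xbar d ∈ M.cone k)
    (hg : inner ℝ (M.g k) (fderiv ℝ c xbar d) ≤ 0) : d ∈ nonAscent (h ∘ c) xbar := by
  set w := fderiv ℝ c xbar d with hw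
  obtain ⟨κ, hκ, hfeas⟩ := exists_feasible_value_le hPLQ hconv hc hx hB
  have hid : Tendsto (fun t : ℝ => t) (𝓝[>] 0) (𝓝 0) := tendsto_id.mono_left nhdsWithin_le_nhds
  have hpos : ∀ᶠ t in 𝓝[>] (0 : ℝ), 0 < t := self_mem_nhdsWithin
  have hpair : Tendsto (fun t : ℝ => ((xbar + t • d, c xbar + t • w) : E n × E m)) (𝓝[>] 0)
      (𝓝 (xbar, c xbar)) := by
    have hcont : Continuous fun t : ℝ => ((xbar + t • d, c xbar + t • w) : E n × E m) := by
      fun_prop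
    simpa using (hcont.tendsto 0).mono_left nhdsWithin_le_nhds
  -- The point c(xbar) + t w need not be a value of c, but it misses c(xbar + t d) by o(t) only.
  -- Regularity therefore corrects xbar + t d by o(t), which does not change the limiting direction.
  have hres : Tendsto (fun t : ℝ => t⁻¹ * ‖c xbar + t • w - c (xbar + t • d)‖) (𝓝[>] 0)
      (𝓝 0) := by
    have h1 := tendsto_difference_quotient ((hc.differentiable one_ne_zero) xbar).hasFDerivAt
      hid hpos (tendsto_const_nhds (x := d))
    have h2 := (tendsto_const_nhds (x := w)).sub h1
    rw [← hw, sub_self] at h2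
    have h3 := h2.norm
    rw [norm_zero] at h3
    refine h3.congr' ?_
    filter_upwards [hpos] with t ht
    have h4 : t⁻¹ • (c xbar + t • w - c (xbar + t • d)) =
        w - t⁻¹ • (c (xbar + t • d) - c xbar) := by
      rw [add_sub_right_comm, smul_add, smul_smul, inv_mul_cancel₀ ht.ne', one_smul,
        ← neg_sub (c (xbar + t • d)), smul_neg]
      abel
    rw [← h4, norm_smul, Real.norm_of_nonneg (inv_pos.2 ht).le]
  have hev := (hpair.eventually hfeas).and (LocalModel.eventually_eq hk)
  have hex : ∀ᶠ t in 𝓝[>] (0 : ℝ), ∃ x', ‖x' - (xbar + t • d)‖ ≤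
      κ * ‖c xbar + t • w - c (xbar + t • d)‖ ∧ c x' ∈ dom h ∧ (h (c x')).toReal ≤
      (h (c xbar)).toReal + t ^ 2 / 2 * inner ℝ w (M.Q k w) +
        κ * ‖c xbar + t • w - c (xbar + t • d)‖ := by
    filter_upwards [hev, hpos] with t ht htp
    obtain ⟨x', h1, h2, h3⟩ := ht.1 (mem_dom_of_eq_coe ht.2)
    refine ⟨x', h1, h2, h3.trans ?_⟩
    rw [ht.2, EReal.toReal_coe]
    linarith [mul_nonpos_of_nonneg_of_nonpos htp.le hg]
  obtain ⟨x', hx'⟩ := hex.choice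
  refine mem_nonAscent_of_tendsto (f := h ∘ c) (l := 𝓝[>] (0 : ℝ)) (t := fun t => t)
    (d' := fun t => t⁻¹ • (x' t - xbar)) (η := fun t => t * (inner ℝ w (M.Q k w) / 2) +
      κ * (t⁻¹ * ‖c xbar + t • w - c (xbar + t • d)‖)) (hPLQ.1.coe_toReal hx).symm hid hpos
    ?_ ?_ ?_
  · have h1 : Tendsto (fun t => t⁻¹ • (x' t - (xbar + t • d))) (𝓝[>] 0) (𝓝 0) := by
      have h2 := hres.const_mul κ
      rw [mul_zero] at h2
      refine squeeze_zero_norm' ?_ h2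
      filter_upwards [hx', hpos] with t ht htp
      rw [norm_smul, Real.norm_of_nonneg (inv_pos.2 htp).le]
      have := mul_le_mul_of_nonneg_left ht.1 (inv_pos.2 htp).le
      linarith
    have h3 := h1.add_const d
    rw [zero_add] at h3
    refine h3.congr' ?_
    filter_upwards [hpos] with t ht
    rw [← sub_sub, smul_sub _ _ (t • d), smul_smul, inv_mul_cancel₀ ht.ne', one_smul,
      sub_add_cancel]
  · have h1 := (hid.mul_const (inner ℝ w (M.Q k w) / 2)).add (hres.const_mul κ)
    simpa using h1
  · filter_upwards [hx', hpos] with t ht htp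
    have h1 : xbar + t • t⁻¹ • (x' t - xbar) = x' t := by
      rw [smul_smul, mul_inv_cancel₀ htp.ne', one_smul, add_sub_cancel]
    simp only [Function.comp_apply]
    rw [h1, hPLQ.1.le_coe_iff ht.2.1]
    refine ht.2.2.trans (le_of_eq ?_)
    field_simp
    ring

/-- Along directions of non-ascent, the directional derivative of `h` is nonpositive. -/
theorem exists_cone_of_mem_nonAscent (hprop : IsProper h) (hc : ContDiff ℝ 1 c)
    (hx : c xbar ∈ dom h) (M : LocalModel h (c xbar)) (hd : d ∈ nonAscent (h ∘ c) xbar) :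
    ∃ k, fderiv ℝ c xbar d ∈ M.cone k ∧ inner ℝ (M.g k) (fderiv ℝ c xbar d) ≤ 0 := by
  rw [mem_nonAscent_iff (f := h ∘ c) (hprop.coe_toReal hx).symm] at hd
  set w := fderiv ℝ c xbar d with hw
  have key : ∀ ε : ℝ, 0 < ε → ∃ k, w ∈ M.cone k ∧ inner ℝ (M.g k) w ≤ ε := by
    intro ε hε
    have := frequently_iff_neBot.1 (hd ε hε)
    obtain ⟨l, hl⟩ := Ultrafilter.exists_le (𝓝[>] (0 : ℝ) ×ˢ 𝓝 d ⊓ 𝓟 {p : ℝ × E n |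
      (h ∘ c) (xbar + p.1 • p.2) ≤ (((h (c xbar)).toReal + p.1 * ε : ℝ) : EReal)})
    have hl1 := hl.trans inf_le_left
    have hle : ∀ᶠ p : ℝ × E n in l,
        h (c (xbar + p.1 • p.2)) ≤ (((h (c xbar)).toReal + p.1 * ε : ℝ) : EReal) :=
      le_principal_iff.1 (hl.trans inf_le_right)
    have ht : Tendsto (fun p : ℝ × E n => p.1) l (𝓝[>] 0) := tendsto_fst.mono_left hl1
    have htd : Tendsto (fun p : ℝ × E n => p.2) l (𝓝 d) := tendsto_snd.mono_left hl1
    have ht0 : ∀ᶠ p : ℝ × E n in l, 0 < p.1 := ht.eventually self_mem_nhdsWithin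
    have ht' : Tendsto (fun p : ℝ × E n => p.1) l (𝓝 0) := ht.mono_right nhdsWithin_le_nhds
    have hq := tendsto_difference_quotient ((hc.differentiable one_ne_zero) xbar).hasFDerivAt
      ht' ht0 htd
    have hrec : ∀ᶠ p : ℝ × E n in l,
        c xbar + p.1 • p.1⁻¹ • (c (xbar + p.1 • p.2) - c xbar) = c (xbar + p.1 • p.2) := by
      filter_upwards [ht0] with p hp
      rw [smul_smul, mul_inv_cancel₀ hp.ne', one_smul, add_sub_cancel]
    obtain ⟨k, hk, hform⟩ := M.exists_piece l ht' ht0 hq (by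
      filter_upwards [hrec, hle] with p hp1 hp2
      rw [hp1]
      exact mem_dom_of_le_coe hp2)
    refine ⟨k, hk, ?_⟩
    set v : ℝ × E n → E m := fun p => p.1⁻¹ • (c (xbar + p.1 • p.2) - c xbar) with hv
    have hlim1 : Tendsto (fun p => inner ℝ (M.g k) (v p) +
        p.1 / 2 * inner ℝ (v p) (M.Q k (v p))) l (𝓝 (inner ℝ (M.g k) w)) := by
      have h1 : Tendsto (fun p => (inner ℝ (M.g k) (v p) : ℝ)) l (𝓝 (inner ℝ (M.g k) w)) :=
        tendsto_const_nhds.inner hq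
      have h2 : Tendsto (fun p => (inner ℝ (v p) (M.Q k (v p)) : ℝ)) l (𝓝 (inner ℝ w (M.Q k w))) :=
        hq.inner (((M.continuous_Q k).tendsto w).comp hq)
      simpa using h1.add ((ht'.div_const 2).mul h2)
    refine le_of_tendsto hlim1 ?_
    filter_upwards [hform, hle, ht0, hrec] with p h1 h2 h3 h4
    have h5 := h1.2 p.1 h3.le le_rfl
    rw [h4] at h5
    rw [h5, EReal.coe_le_coe_iff] at h2
    refine le_of_mul_le_mul_left ?_ h3
    linarith
  -- The piece found for ε depends on ε, but all cones containing w give the same directional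
  -- derivative, so one k can be fixed.
  obtain ⟨k, hk, -⟩ := key 1 one_pos
  refine ⟨k, hk, le_of_forall_pos_le_add fun ε hε => ?_⟩
  obtain ⟨k', hk', hle⟩ := key ε hε
  have := (LocalModel.hasDirDeriv hprop hx hk).unique (LocalModel.hasDirDeriv hprop hx hk')
  rw [EReal.coe_eq_coe_iff] at this
  rw [this, zero_add]
  exact hle

end Ascent

/-! ### From second-order conditions to growth and subregularity. -/

section Sufficiency

variable {n m : ℕ} {h : E m → EReal} {c : E n → E m} {xbar : E n} {ybar : E m}

theorem inner_fderiv_eq_zero {y : E m} (hy : jacT c xbar y = 0) (v : E n) :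
    (inner ℝ y (fderiv ℝ c xbar v) : ℝ) = 0 := by
  rw [← ContinuousLinearMap.adjoint_inner_left, ← jacT, hy, inner_zero_left]

/-- With a single multiplier, the second-order sufficient condition becomes an inequality between
real numbers. -/
theorem SecondOrderSufficient.pos (hprop : IsProper h) (hx : c xbar ∈ dom h)
    (hM : multipliers h c xbar = {ybar}) (hS : SecondOrderSufficient h c xbar)
    (M : LocalModel h (c xbar)) {d : E n} (hd : d ∈ nonAscent (h ∘ c) xbar) (hd0 : d ≠ 0) {k : M.ι}
    (hk : fderiv ℝ c xbar d ∈ M.cone k) :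
    0 < inner ℝ (fderiv ℝ c xbar d) (M.Q k (fderiv ℝ c xbar d)) +
      inner ℝ d (hessLag c ybar xbar d) := by
  obtain ⟨q, μ, hq, hμ, hpos⟩ := hS.2 d ⟨hd, hd0⟩
  rw [hM, Set.image_singleton] at hμ
  obtain rfl : μ = _ := hμ.1
  rw [hq.unique (LocalModel.hasSecondDirDeriv hprop hx hk), ← EReal.coe_add] at hpos
  exact EReal.coe_pos.1 hpos

/-- The second-order sufficient conditions imply strong local minimality. -/
theorem isStrongLocalMin_of_secondOrderSufficient (hPLQ : IsPLQ h)
    (hc : ContDiff ℝ 2 c) (hx : c xbar ∈ dom h) (hM : multipliers h c xbar = {ybar})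
    (hS : SecondOrderSufficient h c xbar) : IsStrongLocalMin (h ∘ c) xbar := by
  have hprop := hPLQ.1
  obtain ⟨M⟩ := hPLQ.nonempty_localModel (c xbar)
  have hy : ybar ∈ multipliers h c xbar := by rw [hM]; rfl
  by_contra hcon
  simp only [IsStrongLocalMin] at hcon
  push Not at hcon
  have hpos : ∀ k : ℕ, (0 : ℝ) < 1 / ((k : ℝ) + 1) := fun k => Nat.one_div_pos_of_nat
  choose u hu hlt using fun k : ℕ =>
    hcon _ (Metric.ball_mem_nhds xbar (hpos k)) (1 / ((k : ℝ) + 1)) (hpos k)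
  have hfx : (h ∘ c) xbar = (((h (c xbar)).toReal : ℝ) : EReal) := (hprop.coe_toReal hx).symm
  set t : ℕ → ℝ := fun k => ‖u k - xbar‖ with ht
  have ht0 : ∀ k, 0 < t k := fun k => by
    refine norm_pos_iff.2 fun h0 => ?_
    have := hlt k
    rw [sub_eq_zero.1 h0] at this
    simp at this
  set d : ℕ → E n := fun k => (t k)⁻¹ • (u k - xbar) with hd
  have hdn : ∀ k, ‖d k‖ = 1 := fun k => by
    rw [hd, norm_smul, norm_inv, Real.norm_of_nonneg (ht0 k).le, inv_mul_cancel₀ (ht0 k).ne']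
  have hud : ∀ k, xbar + t k • d k = u k := fun k => by
    rw [hd, smul_smul, mul_inv_cancel₀ (ht0 k).ne', one_smul, add_sub_cancel]
  set l := hyperfilter ℕ
  have hγ : Tendsto (fun k : ℕ => 1 / ((k : ℝ) + 1)) l (𝓝 0) :=
    tendsto_one_div_add_atTop_nhds_zero_nat.mono_left Nat.hyperfilter_le_atTop
  have htl : Tendsto t l (𝓝 0) :=
    squeeze_zero (fun k => (ht0 k).le) (fun k => (mem_ball_iff_norm.1 (hu k).1).le) hγ
  have hpos' : ∀ᶠ k in l, 0 < t k := Eventually.of_forall ht0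
  obtain ⟨d₀, hd₀⟩ := exists_tendsto_of_eventually_norm_le l (u := d) (R := 1)
    (Eventually.of_forall fun k => (hdn k).le)
  have hd₀0 : d₀ ≠ 0 := by
    rintro rfl
    have : ‖(0 : E n)‖ = 1 := tendsto_nhds_unique hd₀.norm (by simp [hdn])
    simp at this
  set w : ℕ → E m := fun k => (t k)⁻¹ • (c (xbar + t k • d k) - c xbar) with hw
  have hwl : Tendsto w l (𝓝 (fderiv ℝ c xbar d₀)) :=
    tendsto_difference_quotient ((hc.differentiable two_ne_zero) xbar).hasFDerivAt htl hpos' hd₀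
  have hwu : ∀ k, c xbar + t k • w k = c (u k) := fun k => by
    rw [hw, smul_smul, mul_inv_cancel₀ (ht0 k).ne', one_smul, add_sub_cancel, hud]
  obtain ⟨k, hk, hform⟩ := M.exists_piece l htl hpos' hwl
    (Eventually.of_forall fun i => by rw [hwu]; exact (hu i).2)
  have hdesc : ∀ i, (h ∘ c) (u i) ≤
      (((h (c xbar)).toReal + 1 / ((i : ℝ) + 1) * t i ^ 2 : ℝ) : EReal) := fun i => by
    have := (hlt i).le
    rwa [hfx, ← EReal.coe_add] at this
  have hdD : d₀ ∈ nonAscent (h ∘ c) xbar := by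
    refine mem_nonAscent_of_tendsto hfx htl hpos' hd₀
      (η := fun i : ℕ => 1 / ((i : ℝ) + 1) * t i) (by simpa using hγ.mul htl)
      (Eventually.of_forall fun i => ?_)
    rw [hud]
    refine (hdesc i).trans (le_of_eq ?_)
    congr 1
    ring
  have hlast := hS.pos hprop hx hM M hdD hd₀0 hk
  rw [inner_hessLag hc] at hlast
  set r : ℕ → E m := fun k => (t k ^ 2)⁻¹ •
    (c (xbar + t k • d k) - c xbar - t k • fderiv ℝ c xbar (d k)) with hr
  have hrl : Tendsto r l (𝓝 ((1 / 2 : ℝ) • fderiv ℝ (fderiv ℝ c) xbar d₀ d₀)) :=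
    tendsto_second_difference_quotient hc xbar htl hpos' hd₀
  -- The linear term of the expansion of c disappears because ∇c(xbar)ᵀ ybar = 0, so ⟨ybar, w i⟩ is
  -- of order t i.
  have hyr : ∀ i, t i * inner ℝ ybar (r i) = inner ℝ ybar (w i) := fun i => by
    have h1 : t i • r i = w i - fderiv ℝ c xbar (d i) := by
      simp only [hr, hw]
      have h2 : ∀ v : E m, t i • (t i ^ 2)⁻¹ • v = (t i)⁻¹ • v := fun v => by
        rw [smul_smul, pow_two, mul_inv, mul_inv_cancel_left₀ (ht0 i).ne']
      rw [h2, smul_sub, inv_smul_smul₀ (ht0 i).ne']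
    rw [← inner_smul_right, h1, inner_sub_right, inner_fderiv_eq_zero hy.1, sub_zero]
  have hlim : Tendsto (fun i => inner ℝ ybar (r i) + 1 / 2 * inner ℝ (w i) (M.Q k (w i))) l
      (𝓝 (inner ℝ ybar ((1 / 2 : ℝ) • fderiv ℝ (fderiv ℝ c) xbar d₀ d₀) +
        1 / 2 * inner ℝ (fderiv ℝ c xbar d₀) (M.Q k (fderiv ℝ c xbar d₀)))) :=
    (tendsto_const_nhds.inner hrl).add
      ((hwl.inner (((M.continuous_Q k).tendsto _).comp hwl)).const_mul _)
  -- Once ⟨g, w i⟩ is replaced by the smaller ⟨ybar, w i⟩, every term carries the factor (t i)²,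
  -- which is divided out before the limit.
  have hle := le_of_tendsto_of_tendsto hlim hγ (by
    filter_upwards [hform] with i hi
    have h1 := hi.2 (t i) (ht0 i).le le_rfl
    rw [hwu] at h1
    have h2 := hdesc i
    rw [Function.comp_apply, h1, EReal.coe_le_coe_iff] at h2
    have h3 := LocalModel.inner_le hprop hy.2 hi.1
    rw [← hyr] at h3
    refine le_of_mul_le_mul_left ?_ (pow_pos (ht0 i) 2)
    have h4 := mul_le_mul_of_nonneg_left h3 (ht0 i).le
    linarith)
  rw [inner_smul_right] at hle
  linarith

/-- If strong metric subregularity fails at a solution of the generalized equation, there are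
difference quotients witnessing it. -/
theorem exists_seq_of_not_stronglyMetricallySubregular {S : PrimalDual n m → Set (PrimalDual n m)}
    {z : PrimalDual n m} (hz : 0 ∈ S z) (hS : ¬ StronglyMetricallySubregular S z 0) :
    ∃ u v : ℕ → PrimalDual n m, (∀ k, v k ∈ S (u k)) ∧
      (∀ k : ℕ, ‖u k - z‖ < 1 / ((k : ℝ) + 1)) ∧
      ∀ k : ℕ, ((k : ℝ) + 1) * ‖v k‖ < ‖u k - z‖ := by
  have hex : ∀ k : ℕ, ∃ u v, v ∈ S u ∧ ‖u - z‖ < 1 / ((k : ℝ) + 1) ∧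
      ((k : ℝ) + 1) * ‖v‖ < ‖u - z‖ := by
    intro k
    by_contra hcon
    push Not at hcon
    -- Were there no such pair for this k, subregularity would hold with modulus k + 1 on this ball.
    refine hS ⟨hz, k + 1, Metric.ball z (1 / ((k : ℝ) + 1)),
      Metric.ball_mem_nhds _ Nat.one_div_pos_of_nat, fun u hu => ?_⟩
    have hk0 : ((k + 1 : NNReal) : ENNReal) ≠ 0 := by
      rw [Ne, ENNReal.coe_eq_zero]
      positivity
    rw [← ENNReal.div_le_iff' hk0 ENNReal.coe_ne_top, Metric.le_infEDist]
    intro v hv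
    rw [ENNReal.div_le_iff' hk0 ENNReal.coe_ne_top, edist_comm 0 v, edist_dist, edist_dist,
      dist_eq_norm, dist_zero_right, ← ENNReal.ofReal_coe_nnreal,
      ← ENNReal.ofReal_mul (NNReal.coe_nonneg _)]
    refine ENNReal.ofReal_le_ofReal ?_
    simpa using hcon u v hv (mem_ball_iff_norm.1 hu)
  choose u v h1 h2 h3 using hex
  exact ⟨u, v, h1, h2, h3⟩

/-- A subgradient at the end of a segment on which the function is quadratic dominates the
derivative of the quadratic there. -/
theorem add_mul_le_inner_of_mem_subdiff (hprop : IsProper h) {z w y : E m} {t r a q : ℝ}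
    (ht : 0 < t) (hy : y ∈ subdiff h (z + t • w))
    (hform : ∀ s : ℝ, 0 ≤ s → s ≤ t →
      h (z + s • w) = ((r + s * a + s ^ 2 / 2 * q : ℝ) : EReal)) :
    a + t * q ≤ inner ℝ y w := by
  refine le_of_eventually_le_add_mul (r := q / 2) ?_
  filter_upwards [Ioc_mem_nhdsGT ht] with τ hτ
  have hτ0 : 0 < τ := hτ.1
  -- The subgradient inequality is tested at a point just before the end of the segment, then
  -- divided by τ.
  have h1 := hform (t - τ) (by linarith [hτ.2]) (by linarith)
  have h2 := ((mem_subdiff_iff hprop).1 hy).2 _ (mem_dom_of_eq_coe h1)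
  rw [h1, hform t ht.le le_rfl, EReal.toReal_coe, EReal.toReal_coe] at h2
  have h3 : z + (t - τ) • w - (z + t • w) = -(τ • w) := by module
  rw [h3, inner_neg_right, inner_smul_right] at h2
  refine le_of_mul_le_mul_left ?_ hτ0
  linarith

/-- Dual limits of difference quotients of subgradients along sequences whose primal difference
quotient vanishes lie in the polar of the critical cone. -/
theorem inner_nonpos_of_tendsto (hprop : IsProper h) {z : E m} (M : LocalModel h z) {y e₀ : E m}
    (hy : y ∈ subdiff h z) {α : Type*} {l : Filter α} [l.NeBot] {t : α → ℝ} {w e : α → E m}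
    (ht : Tendsto t l (𝓝 0)) (ht0 : ∀ᶠ i in l, 0 < t i) (hw : Tendsto w l (𝓝 0))
    (he : Tendsto e l (𝓝 e₀)) (hsub : ∀ᶠ i in l, y + t i • e i ∈ subdiff h (z + t i • w i))
    {k : M.ι} {v : E m} (hv : v ∈ M.cone k) (hcrit : inner ℝ (M.g k) v = inner ℝ y v) :
    inner ℝ e₀ v ≤ 0 := by
  obtain ⟨ε, hε, hal⟩ := M.along k v hv
  refine le_of_eventually_le_add_mul (r := inner ℝ v (M.Q k v) / 2) ?_
  filter_upwards [self_mem_nhdsWithin] with σ hσ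
  have hσ0 : 0 < σ := hσ
  have hl : Tendsto (fun i => σ * inner ℝ (e i) v - inner ℝ (e i) (w i)) l
      (𝓝 (σ * inner ℝ e₀ v)) := by
    simpa using ((he.inner (tendsto_const_nhds (x := v))).const_mul σ).sub (he.inner hw)
  have hsmall : ∀ᶠ i in l, σ * t i ≤ ε := by
    have h1 := ht.const_mul σ
    rw [mul_zero] at h1
    exact h1.eventually_le_const hε
  refine le_of_mul_le_mul_left (le_of_tendsto hl ?_) hσ0
  -- The subgradient at z + t w is tested at z + σ t v, and y at z + t w. In the sum all first-order
  -- terms cancel, leaving σ⟨e, v⟩ - ⟨e, w⟩ ≤ σ²⟨v, Qv⟩/2 after division by t². Letting i tend along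
  -- l, dividing by σ and sending σ to 0 gives the claim.
  filter_upwards [hsub, ht0, hsmall] with i h1 h2 h3
  obtain ⟨h4, h5⟩ := (mem_subdiff_iff hprop).1 h1
  have h6 := hal (σ * t i) (by positivity) h3
  have h7 := h5 _ (mem_dom_of_eq_coe h6)
  have h8 := ((mem_subdiff_iff hprop).1 hy).2 _ h4
  rw [h6, EReal.toReal_coe, hcrit, add_sub_add_left_eq_sub] at h7
  rw [add_sub_cancel_left] at h8
  simp only [inner_add_left, inner_sub_right, inner_smul_left, inner_smul_right,
    RCLike.conj_to_real] at h7 h8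
  refine le_of_mul_le_mul_left ?_ (pow_pos h2 2)
  linarith

/-- A direction in the polar of the critical cone at `y` is feasible for the subdifferential. -/
theorem exists_add_smul_mem_subdiff (hprop : IsProper h) (hconv : IsConvexFun h) {z : E m}
    (hz : z ∈ dom h) (M : LocalModel h z) {y e : E m} (hy : y ∈ subdiff h z)
    (he : ∀ k, ∀ v ∈ M.cone k, inner ℝ (M.g k) v = inner ℝ y v → inner ℝ e v ≤ 0) :
    ∃ τ : ℝ, 0 < τ ∧ y + τ • e ∈ subdiff h z := by
  have := M.fin
  -- On each cone g - y is nonnegative, and e is nonpositive where it vanishes. Polyhedrality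
  -- upgrades this to a linear bound, so a step of length 1/(1 + ∑ μ) is admissible on all pieces at
  -- once.
  have hμ : ∀ k, ∃ μ : ℝ, 0 ≤ μ ∧ ∀ v ∈ M.cone k,
      inner ℝ e v ≤ μ * inner ℝ (M.g k - y) v := fun k => by
    refine exists_inner_le_mul_inner (M.a k) (M.g k - y) e (fun v hv => ?_) fun v hv h0 => ?_
    · rw [inner_sub_left, sub_nonneg]
      exact LocalModel.inner_le hprop hy hv
    · rw [inner_sub_left, sub_eq_zero] at h0
      exact he k v hv h0
  choose μ hμ0 hμ using hμ
  have hsum : 0 ≤ ∑ k, μ k := Finset.sum_nonneg fun k _ => hμ0 k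
  have hpos : 0 < 1 + ∑ k, μ k := by linarith
  refine ⟨(1 + ∑ k, μ k)⁻¹, inv_pos.2 hpos,
    LocalModel.mem_subdiff_of_inner_le (M := M) hprop hconv hz fun k v hv => ?_⟩
  have h1 := hμ k v hv
  have h2 : 0 ≤ inner ℝ (M.g k - y) v := by
    rw [inner_sub_left, sub_nonneg]
    exact LocalModel.inner_le hprop hy hv
  have h3 : μ k ≤ 1 + ∑ k, μ k := by
    linarith [Finset.single_le_sum (fun k _ => hμ0 k) (Finset.mem_univ k)]
  have h4 := h1.trans (mul_le_mul_of_nonneg_right h3 h2)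
  rw [inner_add_left, inner_smul_left, RCLike.conj_to_real]
  have h5 : (1 + ∑ k, μ k)⁻¹ * inner ℝ e v ≤ inner ℝ (M.g k - y) v := by
    rwa [inv_mul_le_iff₀ hpos]
  rw [inner_sub_left] at h5
  linarith

/-- The second-order sufficient conditions with a unique multiplier imply strong metric
subregularity of the KKT mapping. -/
theorem stronglyMetricallySubregular_of_secondOrderSufficient (hPLQ : IsPLQ h)
    (hconv : IsConvexFun h) (hc : ContDiff ℝ 2 c) (hx : c xbar ∈ dom h) (hB : BCQ h c xbar)
    (hM : multipliers h c xbar = {ybar}) (hS : SecondOrderSufficient h c xbar) :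
    StronglyMetricallySubregular (kktMap h c) (WithLp.toLp 2 (xbar, ybar)) 0 := by
  have hprop := hPLQ.1
  have hc1 : ContDiff ℝ 1 c := hc.of_le one_le_two
  have hclosed := hPLQ.isClosed_epigraph
  obtain ⟨M⟩ := hPLQ.nonempty_localModel (c xbar)
  have hy : ybar ∈ multipliers h c xbar := by rw [hM]; rfl
  have hzero : (0 : PrimalDual n m) ∈ kktMap h c (WithLp.toLp 2 (xbar, ybar)) := by
    rw [mem_kktMap_iff hprop hconv hclosed]
    exact ⟨by simpa using hy.1.symm, by simpa using hy.2⟩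
  by_contra hcon
  obtain ⟨u, v, hv, hu, hlt⟩ := exists_seq_of_not_stronglyMetricallySubregular hzero hcon
  simp only [mem_kktMap_iff hprop hconv hclosed] at hv
  set t : ℕ → ℝ := fun k => ‖u k - WithLp.toLp 2 (xbar, ybar)‖ with ht
  have ht0 : ∀ k, 0 < t k := fun k => lt_of_le_of_lt (by positivity) (hlt k)
  set d : ℕ → E n := fun k => (t k)⁻¹ • ((u k).fst - xbar) with hd
  set e : ℕ → E m := fun k => (t k)⁻¹ • ((u k).snd - ybar) with he
  have hsq : ∀ k, ‖d k‖ ^ 2 + ‖e k‖ ^ 2 = 1 := fun k => by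
    have h1 : t k ^ 2 = ‖(u k).fst - xbar‖ ^ 2 + ‖(u k).snd - ybar‖ ^ 2 :=
      WithLp.prod_norm_sq_eq_of_L2 (u k - WithLp.toLp 2 (xbar, ybar))
    simp only [hd, he, norm_smul, norm_inv, Real.norm_of_nonneg (ht0 k).le, mul_pow, ← mul_add]
    rw [← h1, ← mul_pow, inv_mul_cancel₀ (ht0 k).ne', one_pow]
  have hdx : ∀ k, xbar + t k • d k = (u k).fst := fun k => by
    rw [hd, smul_smul, mul_inv_cancel₀ (ht0 k).ne', one_smul, add_sub_cancel]
  have hey : ∀ k, ybar + t k • e k = (u k).snd := fun k => by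
    rw [he, smul_smul, mul_inv_cancel₀ (ht0 k).ne', one_smul, add_sub_cancel]
  set l := hyperfilter ℕ
  have hγ : Tendsto (fun k : ℕ => 1 / ((k : ℝ) + 1)) l (𝓝 0) :=
    tendsto_one_div_add_atTop_nhds_zero_nat.mono_left Nat.hyperfilter_le_atTop
  have htl : Tendsto t l (𝓝 0) := squeeze_zero (fun k => (ht0 k).le) (fun k => (hu k).le) hγ
  have hpos : ∀ᶠ k in l, 0 < t k := Eventually.of_forall ht0
  obtain ⟨d₀, hd₀⟩ := exists_tendsto_of_eventually_norm_le l (u := d) (R := 1)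
    (Eventually.of_forall fun k => by
      have := hsq k
      exact abs_le_one_iff_mul_self_le_one.2 (by nlinarith [sq_nonneg ‖e k‖]) |> le_of_abs_le)
  obtain ⟨e₀, he₀⟩ := exists_tendsto_of_eventually_norm_le l (u := e) (R := 1)
    (Eventually.of_forall fun k => by
      have := hsq k
      exact abs_le_one_iff_mul_self_le_one.2 (by nlinarith [sq_nonneg ‖d k‖]) |> le_of_abs_le)
  have hsq₀ : ‖d₀‖ ^ 2 + ‖e₀‖ ^ 2 = 1 :=
    tendsto_nhds_unique ((hd₀.norm.pow 2).add (he₀.norm.pow 2)) (by simp [hsq])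
  have hvl : Tendsto (fun k => (t k)⁻¹ • v k) l (𝓝 0) := by
    refine squeeze_zero_norm (fun k => ?_) hγ
    have hk : (0 : ℝ) < (k : ℝ) + 1 := by positivity
    rw [norm_smul, norm_inv, Real.norm_of_nonneg (ht0 k).le, inv_mul_le_iff₀ (ht0 k),
      mul_one_div, le_div_iff₀ hk, mul_comm]
    exact (hlt k).le
  have hv1 : Tendsto (fun k => (t k)⁻¹ • (v k).fst) l (𝓝 0) := by
    refine squeeze_zero_norm (fun k => ?_) (tendsto_norm_zero.comp hvl)
    simpa using WithLp.norm_fst_le _ ((t k)⁻¹ • v k)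
  have hv2 : Tendsto (fun k => (t k)⁻¹ • (v k).snd) l (𝓝 0) := by
    refine squeeze_zero_norm (fun k => ?_) (tendsto_norm_zero.comp hvl)
    simpa using WithLp.norm_snd_le _ ((t k)⁻¹ • v k)
  -- The perturbation (v k).snd is absorbed into w, so that the subgradient sits exactly at c(xbar)
  -- + t w. Being o(t), it does not affect the limit.
  obtain ⟨w, hw⟩ : ∃ w : ℕ → E m, ∀ k,
      (t k)⁻¹ • (c (xbar + t k • d k) - c xbar) + (t k)⁻¹ • (v k).snd = w k := ⟨_, fun _ => rfl⟩
  have hwl : Tendsto w l (𝓝 (fderiv ℝ c xbar d₀)) := by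
    have := (tendsto_difference_quotient ((hc.differentiable two_ne_zero) xbar).hasFDerivAt
      htl hpos hd₀).add hv2
    rw [add_zero] at this
    exact this.congr hw
  have hwz : ∀ k, c xbar + t k • w k = c (u k).fst + (v k).snd := fun k => by
    rw [← hw, hdx, smul_add, smul_inv_smul₀ (ht0 k).ne', smul_inv_smul₀ (ht0 k).ne']
    abel
  have hsub : ∀ k, ybar + t k • e k ∈ subdiff h (c xbar + t k • w k) := fun k => by
    rw [hey, hwz]
    exact (hv k).2
  -- This is the linearized stationarity equation, the limit of the first KKT component divided by
  -- t.
  have hKKT : hessLag c ybar xbar d₀ + jacT c xbar e₀ = 0 := by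
    have h1 := tendsto_difference_quotient (hasFDerivAt_jacT hc ybar xbar) htl hpos hd₀
    have hxl : Tendsto (fun k => xbar + t k • d k) l (𝓝 xbar) := by
      simpa using tendsto_const_nhds.add (htl.smul hd₀)
    have h2 := tendsto_jacT_apply hc1 hxl he₀
    refine tendsto_nhds_unique (h1.add h2) (hv1.congr fun k => ?_)
    rw [(hv k).1, ← hey, ← hdx, show jacT c xbar ybar = 0 from hy.1, sub_zero, map_add, map_smul,
      smul_add, inv_smul_smul₀ (ht0 k).ne']
  obtain ⟨k, hk, hform⟩ := M.exists_piece l htl hpos hwl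
    (Eventually.of_forall fun i => ((mem_subdiff_iff hprop).1 (hsub i)).1)
  have hwQ : Tendsto (fun i => (inner ℝ (w i) (M.Q k (w i)) : ℝ)) l
      (𝓝 (inner ℝ (fderiv ℝ c xbar d₀) (M.Q k (fderiv ℝ c xbar d₀)))) :=
    hwl.inner (((M.continuous_Q k).tendsto _).comp hwl)
  have hineq : ∀ᶠ i in l, inner ℝ (M.g k) (w i) + t i * inner ℝ (w i) (M.Q k (w i)) ≤
      inner ℝ ybar (w i) + t i * inner ℝ (e i) (w i) := by
    filter_upwards [hform] with i hi
    have := add_mul_le_inner_of_mem_subdiff hprop (ht0 i) (hsub i) hi.2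
    rwa [inner_add_left, inner_smul_left, RCLike.conj_to_real] at this
  have hg : inner ℝ (M.g k) (fderiv ℝ c xbar d₀) ≤ 0 := by
    have h1 : Tendsto (fun i => inner ℝ (M.g k) (w i) + t i * inner ℝ (w i) (M.Q k (w i))) l
        (𝓝 (inner ℝ (M.g k) (fderiv ℝ c xbar d₀))) := by
      simpa using (tendsto_const_nhds.inner hwl).add (htl.mul hwQ)
    have h2 : Tendsto (fun i => inner ℝ ybar (w i) + t i * inner ℝ (e i) (w i)) l (𝓝 0) := by
      simpa [inner_fderiv_eq_zero hy.1] using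
        ((tendsto_const_nhds (x := ybar)).inner hwl).add (htl.mul (he₀.inner hwl))
    exact le_of_tendsto_of_tendsto h1 h2 hineq
  -- The inequality ⟨ybar, w⟩ ≤ ⟨g, w⟩ cancels the leading terms of `hineq`, and the remaining
  -- factor t is divided out.
  have hq : inner ℝ (fderiv ℝ c xbar d₀) (M.Q k (fderiv ℝ c xbar d₀)) ≤
      inner ℝ e₀ (fderiv ℝ c xbar d₀) := by
    refine le_of_tendsto_of_tendsto hwQ (he₀.inner hwl) ?_
    filter_upwards [hineq, hform] with i h1 h2
    have h3 := LocalModel.inner_le hprop hy.2 h2.1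
    refine le_of_mul_le_mul_left ?_ (ht0 i)
    linarith
  have hd₀0 : d₀ = 0 := by
    by_contra hne
    have h1 := hS.pos hprop hx hM M
      (mem_nonAscent_of_inner_nonpos hPLQ hconv hc1 hx hB M hk hg) hne hk
    -- Pairing the linearized equation with d₀ makes the Hessian term equal to -⟨e₀, Ad₀⟩ ≤ -⟨Ad₀,
    -- QAd₀⟩, contrary to positivity.
    have h2 : (inner ℝ d₀ (hessLag c ybar xbar d₀ + jacT c xbar e₀) : ℝ) = 0 := by
      rw [hKKT, inner_zero_right]
    rw [inner_add_right, jacT, ContinuousLinearMap.adjoint_inner_right,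
      real_inner_comm e₀] at h2
    linarith
  subst hd₀0
  rw [map_zero, zero_add] at hKKT
  rw [map_zero] at hwl
  -- With d₀ = 0 the whole unit length is in e₀, which now produces a second multiplier.
  obtain ⟨τ, hτ, hmem⟩ := exists_add_smul_mem_subdiff hprop hconv hx M hy.2 (e := e₀)
    fun k v hv hcrit => inner_nonpos_of_tendsto hprop M hy.2 htl hpos hwl he₀
      (Eventually.of_forall hsub) hv hcrit
  have hmem' : ybar + τ • e₀ ∈ multipliers h c xbar := by
    refine ⟨?_, hmem⟩
    change jacT c xbar (ybar + τ • e₀) = 0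
    rw [map_add, map_smul, hKKT, smul_zero, add_zero]
    exact hy.1
  rw [hM, Set.mem_singleton_iff, add_eq_left, smul_eq_zero] at hmem'
  rcases hmem' with h0 | h0
  · exact hτ.ne' h0
  · simp [h0] at hsq₀

end Sufficiency

theorem nonneg_of_forall_le_mul_add {σ X C : ℝ} (H : ∀ r : ℝ, 0 < r → σ ≤ r * X + C) : 0 ≤ X := by
  by_contra hX
  push Not at hX
  have h1 := H ((|C - σ| + 1) / (-X)) (div_pos (by positivity) (neg_pos.2 hX))
  have h2 : (|C - σ| + 1) / (-X) * X = -(|C - σ| + 1) := by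
    rw [div_neg, neg_mul, div_mul_cancel₀ _ hX.ne]
  linarith [le_abs_self (C - σ)]

/-! ### Multipliers by convex separation. -/

section Duality

variable {n m : ℕ} {h : E m → EReal}

theorem convex_setOf_add_norm_lt {m : ℕ} (b : E m) {L : ℝ} (hL : 0 ≤ L) (σ : ℝ) :
    Convex ℝ {p : E m × ℝ | p.2 + L * ‖p.1 - b‖ < σ} := by
  have h1 : ConvexOn ℝ Set.univ fun p : E m × ℝ => p.2 + L * ‖p.1 - b‖ := by
    refine ⟨convex_univ, fun p _ q _ s t hs ht hst => ?_⟩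
    have h2 : (s • p + t • q).1 - b = s • (p.1 - b) + t • (q.1 - b) := by
      have : b = s • b + t • b := by rw [← add_smul, hst, one_smul]
      nth_rewrite 1 [this]
      simp only [Prod.fst_add, Prod.smul_fst, smul_sub]
      abel
    have h3 : ‖(s • p + t • q).1 - b‖ ≤ s * ‖p.1 - b‖ + t * ‖q.1 - b‖ := by
      rw [h2]
      refine (norm_add_le _ _).trans (le_of_eq ?_)
      rw [norm_smul, norm_smul, Real.norm_of_nonneg hs, Real.norm_of_nonneg ht]
    have h4 := mul_le_mul_of_nonneg_left h3 hL
    simp only [Prod.snd_add, Prod.smul_snd, smul_eq_mul]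
    linarith
  simpa using h1.convex_lt σ

open scoped Pointwise in
/-- Duality for the exact penalization of a linearized convex-composite problem: a uniform lower
bound on the primal values yields a multiplier. -/
theorem exists_multiplier_of_forall_le (hprop : IsProper h) (hconv : IsConvexFun h) {z : E m}
    (hz : z ∈ dom h) (A : E n →L[ℝ] E m) (b : E m) {L σ : ℝ} (hL : 0 ≤ L)
    (H : ∀ ζ ∈ dom h, ∀ r : ℝ, 0 < r → ∀ p : E n,
      σ ≤ r * ((h ζ).toReal - (h z).toReal) + L * ‖r • (ζ - z) - A p - b‖) :
    ∃ y ∈ subdiff h z, ContinuousLinearMap.adjoint A y = 0 ∧ σ ≤ inner ℝ y b := by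
  -- T is the epigraph moved so that (z, h(z)) becomes the origin. Its conic hull minus range A ×
  -- {0} is separated from an open convex set encoding the penalty; the hypothesis says precisely
  -- that they are disjoint.
  set T : Set (E m × ℝ) := (fun p => (z, (h z).toReal) + p) ⁻¹' {p | h p.1 ≤ (p.2 : EReal)} with hT
  have hTc : Convex ℝ T := hconv.translate_preimage_right _
  have hTmem : ∀ ζ ∈ dom h, (ζ - z, (h ζ).toReal - (h z).toReal) ∈ T := fun ζ hζ => by
    change h (z + (ζ - z)) ≤ (((h z).toReal + ((h ζ).toReal - (h z).toReal) : ℝ) : EReal)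
    rw [add_sub_cancel, add_sub_cancel, hprop.coe_toReal hζ]
  set R : Submodule ℝ (E m × ℝ) :=
    LinearMap.range ((LinearMap.inl ℝ (E m) ℝ).comp (A : E n →ₗ[ℝ] E m)) with hR
  set S : Set (E m × ℝ) := (ConvexCone.hull ℝ T : Set (E m × ℝ)) - (R : Set (E m × ℝ)) with hS
  have hSc : Convex ℝ S := (ConvexCone.hull ℝ T).convex.sub R.convex
  have hSmem : ∀ ζ ∈ dom h, ∀ r : ℝ, 0 < r → ∀ p : E n,
      (r • (ζ - z) - A p, r * ((h ζ).toReal - (h z).toReal)) ∈ S := fun ζ hζ r hr p => by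
    refine ⟨r • (ζ - z, (h ζ).toReal - (h z).toReal),
      (ConvexCone.mem_hull_of_convex hTc).2 ⟨r, hr, _, hTmem ζ hζ, rfl⟩, (A p, 0), ⟨p, rfl⟩, ?_⟩
    simp
  have hdisj : Disjoint {p : E m × ℝ | p.2 + L * ‖p.1 - b‖ < σ} S := by
    rw [Set.disjoint_left]
    rintro p hp ⟨q, hq, -, ⟨x, rfl⟩, rfl⟩
    obtain ⟨r, hr, ⟨v, ρ⟩, hv, rfl⟩ := (ConvexCone.mem_hull_of_convex hTc).1 hq
    have hv' : h (z + v) ≤ (((h z).toReal + ρ : ℝ) : EReal) := hv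
    have hdom := mem_dom_of_le_coe hv'
    rw [hprop.le_coe_iff hdom] at hv'
    have h1 := H _ hdom r hr x
    have h2 : r * ρ + L * ‖r • v - A x - b‖ < σ := by simpa using hp
    rw [add_sub_cancel_left] at h1
    have h3 := mul_le_mul_of_nonneg_left hv' hr.le
    linarith
  obtain ⟨f, u, hf1, hf2⟩ := geometric_hahn_banach_open (convex_setOf_add_norm_lt b hL σ)
    (isOpen_lt (by fun_prop) continuous_const) hSc hdisj
  obtain ⟨a, ha⟩ : ∃ a : E m, ∀ v, f (v, 0) = inner ℝ a v := by
    refine ⟨(InnerProductSpace.toDual ℝ (E m)).symm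
      (f.comp (ContinuousLinearMap.inl ℝ (E m) ℝ)), fun v => ?_⟩
    simp
  have hf : ∀ v t, f (v, t) = inner ℝ a v + t * f (0, 1) := fun v t => by
    rw [← ha, ← smul_eq_mul, ← map_smul, ← map_add]
    simp
  set s := f (0, 1) with hs
  have hlow : ∀ v t, t + L * ‖v - b‖ < σ → inner ℝ a v + t * s < u := fun v t hvt => by
    rw [← hf]
    exact hf1 _ hvt
  have hup : ∀ ζ ∈ dom h, ∀ r : ℝ, 0 < r → ∀ p : E n,
      u ≤ inner ℝ a (r • (ζ - z) - A p) + r * ((h ζ).toReal - (h z).toReal) * s :=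
    fun ζ hζ r hr p => by
      rw [← hf]
      exact hf2 _ (hSmem ζ hζ r hr p)
  have hu0 : ∀ p, u ≤ -inner ℝ a (A p) := fun p => by simpa using hup z hz 1 one_pos p
  have hs0 : 0 ≤ s := by
    refine nonneg_of_forall_le_mul_add (σ := -u) (C := (-σ + 1) * s - inner ℝ a b) fun r hr => ?_
    have h1 := hlow b (σ - 1 - r) (by simp; linarith)
    linarith
  -- The separating hyperplane is not vertical: the open set projects onto the whole space, so s = 0
  -- would give 0 < u at v = 0, whereas u ≤ 0.
  have hspos : 0 < s := by
    refine lt_of_le_of_ne hs0 fun h0 => ?_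
    have h1 := hlow 0 (σ - 1 - L * ‖0 - b‖) (by linarith)
    have h2 := hu0 0
    rw [← h0] at h1
    simp at h1 h2
    linarith
  have hσ : inner ℝ a b + σ * s ≤ u := by
    refine le_of_forall_pos_lt_add fun ε hε => ?_
    have h1 := hlow b (σ - ε / s) (by simpa using div_pos hε hspos)
    rw [sub_mul, div_mul_cancel₀ _ hspos.ne'] at h1
    linarith
  have hA : ContinuousLinearMap.adjoint A a = 0 := by
    set q := ContinuousLinearMap.adjoint A a with hq
    have h1 : 0 ≤ -‖q‖ ^ 2 := by
      refine nonneg_of_forall_le_mul_add (σ := u) (C := 0) fun r hr => ?_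
      have h2 := hu0 (r • q)
      rw [map_smul, inner_smul_right, ← ContinuousLinearMap.adjoint_inner_left, ← hq,
        real_inner_self_eq_norm_sq] at h2
      linarith
    have h2 : ‖q‖ ^ 2 = 0 := le_antisymm (by linarith) (sq_nonneg _)
    simpa using h2
  refine ⟨-s⁻¹ • a, (mem_subdiff_iff hprop).2 ⟨hz, fun ζ hζ => ?_⟩, ?_, ?_⟩
  · have h1 : 0 ≤ inner ℝ a (ζ - z) + ((h ζ).toReal - (h z).toReal) * s := by
      refine nonneg_of_forall_le_mul_add (σ := u) (C := 0) fun r hr => ?_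
      have h2 := hup ζ hζ r hr 0
      rw [map_zero, sub_zero, inner_smul_right] at h2
      linarith
    have h2 := mul_nonneg (inv_pos.2 hspos).le h1
    rw [mul_add, mul_comm _ s, inv_mul_cancel_left₀ hspos.ne'] at h2
    rw [inner_smul_left, RCLike.conj_to_real]
    linarith
  · rw [map_smul, hA, smul_zero]
  · have h1 := hu0 0
    simp only [map_zero, inner_zero_right, neg_zero] at h1
    have h2 : s⁻¹ * (inner ℝ a b + σ * s) ≤ 0 :=
      mul_nonpos_of_nonneg_of_nonpos (inv_pos.2 hspos).le (by linarith)
    rw [mul_add, mul_comm σ, inv_mul_cancel_left₀ hspos.ne'] at h2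
    rw [inner_smul_left, RCLike.conj_to_real]
    linarith

end Duality

/-! ### From subregularity and growth to second-order conditions. -/

section Necessity

variable {n m : ℕ} {h : E m → EReal} {c : E n → E m} {xbar : E n} {ybar : E m}

theorem StronglyMetricallySubregular.eventually_eq_of_mem {X Y : Type*} [MetricSpace X]
    [PseudoEMetricSpace Y] {S : X → Set Y} {x : X} {y : Y}
    (hS : StronglyMetricallySubregular S x y) : ∀ᶠ u in 𝓝 x, y ∈ S u → u = x := by
  obtain ⟨-, κ, U, hU, hκ⟩ := hS
  filter_upwards [hU] with u hu hy
  have := hκ u hu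
  rw [Metric.infEDist_zero_of_mem hy, mul_zero, nonpos_iff_eq_zero, edist_eq_zero] at this
  exact this

/-- The multiplier set is convex, so a second multiplier would put solutions of the KKT system
arbitrarily close to (xbar, ybar), which subregularity forbids. -/
theorem multipliers_eq_singleton_of_stronglyMetricallySubregular (hPLQ : IsPLQ h)
    (hconv : IsConvexFun h)
    (hS : StronglyMetricallySubregular (kktMap h c) (WithLp.toLp 2 (xbar, ybar)) 0) :
    multipliers h c xbar = {ybar} := by
  have hprop := hPLQ.1
  have hiff : ∀ y, (0 : PrimalDual n m) ∈ kktMap h c (WithLp.toLp 2 (xbar, y)) ↔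
      y ∈ multipliers h c xbar := fun y => by
    rw [mem_kktMap_iff hprop hconv hPLQ.isClosed_epigraph, WithLp.zero_fst, WithLp.zero_snd,
      add_zero, eq_comm]
    rfl
  have hy : ybar ∈ multipliers h c xbar := (hiff ybar).1 hS.1
  refine Set.eq_singleton_iff_unique_mem.2 ⟨hy, fun y hy' => ?_⟩
  have hlim : Tendsto (fun s : ℝ => (WithLp.toLp 2 (xbar, ybar + s • (y - ybar)) : PrimalDual n m))
      (𝓝[>] 0) (𝓝 (WithLp.toLp 2 (xbar, ybar))) := by
    have hcont : Continuous fun s : ℝ =>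
        (WithLp.toLp 2 (xbar, ybar + s • (y - ybar)) : PrimalDual n m) := by fun_prop
    simpa using (hcont.tendsto 0).mono_left nhdsWithin_le_nhds
  obtain ⟨s, hs, hs01⟩ := ((hlim.eventually hS.eventually_eq_of_mem).and
    (Ioc_mem_nhdsGT (zero_lt_one' ℝ))).exists
  have hmem : ybar + s • (y - ybar) ∈ multipliers h c xbar := by
    refine ⟨?_, (convex_subdiff hprop _).add_smul_sub_mem hy.2 hy'.2 ⟨hs01.1.le, hs01.2⟩⟩
    change jacT c xbar (ybar + s • (y - ybar)) = 0
    rw [map_add, map_smul, map_sub, show jacT c xbar ybar = 0 from hy.1,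
      show jacT c xbar y = 0 from hy'.1]
    simp
  have heq : ybar + s • (y - ybar) = ybar := congrArg WithLp.snd (hs ((hiff _).2 hmem))
  rw [add_eq_left, smul_eq_zero, sub_eq_zero] at heq
  exact heq.resolve_left hs01.1.ne'

/-- Under the basic constraint qualification, quadratic growth of `h ∘ c` yields quadratic growth
of an exact penalization. -/
theorem IsStrongLocalMin.exists_penalized_growth (hPLQ : IsPLQ h) (hconv : IsConvexFun h)
    (hc : ContDiff ℝ 1 c) (hx : c xbar ∈ dom h) (hB : BCQ h c xbar)
    (hmin : IsStrongLocalMin (h ∘ c) xbar) :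
    ∃ L γ : ℝ, 0 ≤ L ∧ 0 < γ ∧ ∀ᶠ p : E n × E m in 𝓝 (xbar, c xbar), p.2 ∈ dom h →
      (h (c xbar)).toReal + γ * ‖p.1 - xbar‖ ^ 2 ≤ (h p.2).toReal + L * ‖p.2 - c p.1‖ := by
  have hprop := hPLQ.1
  obtain ⟨U, hU, γ, hγ, hgrow⟩ := hmin
  obtain ⟨κ, hκ, hfeas⟩ := exists_feasible_value_le hPLQ hconv hc hx hB
  obtain ⟨ρ, hρ, hρU⟩ := Metric.mem_nhds_iff.1 hU
  have hsmall : ∀ᶠ p : E n × E m in 𝓝 (xbar, c xbar),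
      ‖p.1 - xbar‖ + κ * ‖p.2 - c p.1‖ < min ρ 1 := by
    have hcont : Continuous fun p : E n × E m => ‖p.1 - xbar‖ + κ * ‖p.2 - c p.1‖ := by
      have := hc.continuous
      fun_prop
    exact (hcont.tendsto (xbar, c xbar)).eventually_lt_const (by simpa using hρ)
  -- Growth holds at the corrected point x'. Returning to x uses ‖x - xbar‖² ≤ 2‖x' - x‖² + 2‖x' -
  -- xbar‖², which halves γ; since ‖x' - x‖ ≤ 1, its square is absorbed into the linear penalty.
  refine ⟨κ + γ * κ, γ / 2, by positivity, half_pos hγ, ?_⟩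
  filter_upwards [hfeas, hsmall] with ⟨x, z⟩ h1 h2 hz
  simp only at h1 h2 hz ⊢
  obtain ⟨x', h3, h4, h5⟩ := h1 hz
  have h6 : ‖x' - xbar‖ ≤ ‖x' - x‖ + ‖x - xbar‖ := norm_sub_le_norm_sub_add_norm_sub _ _ _
  have h7 : x' ∈ U := hρU (mem_ball_iff_norm.2 (by linarith [min_le_left ρ 1]))
  have h8 := hgrow x' ⟨h7, h4⟩
  simp only [Function.comp_apply] at h8
  rw [← hprop.coe_toReal hx, ← hprop.coe_toReal h4, ← EReal.coe_add, EReal.coe_le_coe_iff] at h8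
  have h9 : ‖x - xbar‖ ≤ ‖x' - x‖ + ‖x' - xbar‖ := by
    have := norm_sub_le_norm_sub_add_norm_sub x x' xbar
    rwa [norm_sub_rev x x'] at this
  have h10 : ‖x' - x‖ ≤ 1 := by linarith [min_le_right ρ 1, norm_nonneg (x - xbar)]
  have h11 : ‖x' - x‖ ^ 2 ≤ κ * ‖z - c x‖ := by
    refine le_trans ?_ h3
    rw [pow_two]
    exact mul_le_of_le_one_left (norm_nonneg _) h10
  have h12 : ‖x - xbar‖ ^ 2 ≤ 2 * ‖x' - x‖ ^ 2 + 2 * ‖x' - xbar‖ ^ 2 := by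
    have := pow_le_pow_left₀ (norm_nonneg _) h9 2
    linarith [sq_nonneg (‖x' - x‖ - ‖x' - xbar‖)]
  have h13 := mul_le_mul_of_nonneg_left h11 hγ.le
  have h14 := mul_le_mul_of_nonneg_left h12 hγ.le
  linarith

/-- Quadratic growth of the penalization bounds the second-order linearization from below. -/
theorem le_of_penalized_growth (hprop : IsProper h) (hconv : IsConvexFun h) (hc : ContDiff ℝ 2 c)
    {L γ : ℝ}
    (hgrow : ∀ᶠ p : E n × E m in 𝓝 (xbar, c xbar), p.2 ∈ dom h →
      (h (c xbar)).toReal + γ * ‖p.1 - xbar‖ ^ 2 ≤ (h p.2).toReal + L * ‖p.2 - c p.1‖)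
    {d : E n} {q : ℝ} (hq : ∀ᶠ t in 𝓝[>] (0 : ℝ), h (c xbar + t • fderiv ℝ c xbar d) =
      (((h (c xbar)).toReal + t ^ 2 / 2 * q : ℝ) : EReal))
    {ζ : E m} (hζ : ζ ∈ dom h) {r : ℝ} (hr : 0 < r) (p : E n) :
    2 * (γ * ‖d‖ ^ 2) ≤ r * ((h ζ).toReal - (h (c xbar)).toReal) + q +
      L * ‖r • (ζ - c xbar) - fderiv ℝ c xbar p - fderiv ℝ (fderiv ℝ c) xbar d d‖ := by
  have hcv := hconv.convexOn hprop
  set z := c xbar with hz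
  set A := fderiv ℝ c xbar with hA
  set b := fderiv ℝ (fderiv ℝ c) xbar d d with hb
  set l : Filter ℝ := 𝓝[>] 0
  have hid : Tendsto (fun t : ℝ => t) l (𝓝 0) := tendsto_id.mono_left nhdsWithin_le_nhds
  have hpos : ∀ᶠ t in l, 0 < t := self_mem_nhdsWithin
  -- The weight θ = r t²/2 makes Z t the convex combination (1 - θ)(z + t/(1 - θ) Ad) + θ ζ, so
  -- convexity bounds h(Z t) by the values on the ray and at ζ.
  obtain ⟨θ, hθ⟩ : ∃ θ : ℝ → ℝ, ∀ t, θ t = t ^ 2 / 2 * r := ⟨_, fun _ => rfl⟩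
  have hθl : Tendsto θ l (𝓝 0) := by
    have hcont : Continuous fun t : ℝ => t ^ 2 / 2 * r := by fun_prop
    have h1 : Tendsto (fun t : ℝ => t ^ 2 / 2 * r) l (𝓝 0) := by
      simpa using (hcont.tendsto 0).mono_left nhdsWithin_le_nhds
    exact h1.congr fun t => (hθ t).symm
  have hθ1 : ∀ᶠ t in l, θ t < 1 := hθl.eventually_lt_const one_pos
  have hθinv : Tendsto (fun t => (1 - θ t)⁻¹) l (𝓝 1) := by
    have h1 := (hθl.const_sub 1).inv₀ (by norm_num)
    simpa using h1
  have htl : Tendsto (fun t => t * (1 - θ t)⁻¹) l (𝓝[>] 0) := by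
    refine tendsto_nhdsWithin_iff.2 ⟨by simpa using hid.mul hθinv, ?_⟩
    filter_upwards [hpos, hθ1] with t h1 h2
    exact mul_pos h1 (inv_pos.2 (sub_pos.2 h2))
  -- The test points x follow the parabolic arc xbar + t d + (t²/2) p.
  obtain ⟨d', hd'⟩ : ∃ d' : ℝ → E n, ∀ t, d' t = d + (t / 2) • p := ⟨_, fun _ => rfl⟩
  have hd'l : Tendsto d' l (𝓝 d) := by
    have hcont : Continuous fun t : ℝ => d + (t / 2) • p := by fun_prop
    have h1 : Tendsto (fun t : ℝ => d + (t / 2) • p) l (𝓝 d) := by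
      simpa using (hcont.tendsto 0).mono_left nhdsWithin_le_nhds
    exact h1.congr fun t => (hd' t).symm
  have hR := tendsto_second_difference_quotient hc xbar hid hpos hd'l
  rw [← hA, ← hb, ← hz] at hR
  set R : ℝ → E m := fun t => (t ^ 2)⁻¹ • (c (xbar + t • d' t) - z - t • A (d' t))
  set Z : ℝ → E m := fun t => z + t • A d + (t ^ 2 / 2 * r) • (ζ - z) with hZ
  have hpair : Tendsto (fun t => (xbar + t • d' t, Z t)) l (𝓝 (xbar, z)) := by
    refine Tendsto.prodMk_nhds ?_ ?_
    · simpa using tendsto_const_nhds.add (hid.smul hd'l)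
    · have hcont : Continuous Z := by fun_prop
      simpa [hZ] using (hcont.tendsto 0).mono_left (nhdsWithin_le_nhds (s := Set.Ioi (0 : ℝ)))
  have hZval : ∀ᶠ t in l, Z t ∈ dom h ∧ (h (Z t)).toReal ≤ (h z).toReal +
      t ^ 2 * (r / 2 * ((h ζ).toReal - (h z).toReal) + q / 2 * (1 - θ t)⁻¹) := by
    filter_upwards [hpos, hθ1, htl.eventually hq] with t h1 h2 h3
    have h4 : 0 < 1 - θ t := sub_pos.2 h2
    have hθ0 : 0 ≤ θ t := by rw [hθ]; positivity
    have h5 := mem_dom_of_eq_coe h3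
    have h6 : (1 - θ t) • (z + (t * (1 - θ t)⁻¹) • A d) + θ t • ζ = Z t := by
      rw [smul_add, smul_smul, mul_comm t, mul_inv_cancel_left₀ h4.ne', hZ]
      simp only [← hθ]
      module
    have h7 := hcv.1 h5 hζ h4.le hθ0 (sub_add_cancel 1 _)
    have h8 := hcv.2 h5 hζ h4.le hθ0 (sub_add_cancel 1 _)
    simp only [h6, h3, EReal.toReal_coe, smul_eq_mul] at h7 h8
    refine ⟨h7, h8.trans (le_of_eq ?_)⟩
    have h9 : (1 - θ t) * ((t * (1 - θ t)⁻¹) ^ 2 / 2 * q) = t ^ 2 / 2 * q * (1 - θ t)⁻¹ := by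
      field_simp
    rw [mul_add (1 - θ t), h9, hθ]
    ring
  -- The terms t Ad cancel between Z t and the expansion of c, so the residual is of order t², like
  -- the growth term.
  have hres : ∀ᶠ t in l, ‖Z t - c (xbar + t • d' t)‖ =
      t ^ 2 * ‖(1 / 2 : ℝ) • (r • (ζ - z) - A p) - R t‖ := by
    filter_upwards [hpos] with t ht
    have h1 : (t ^ 2) • R t = c (xbar + t • d' t) - z - t • A (d' t) :=
      smul_inv_smul₀ (pow_pos ht 2).ne' _
    have h2 : Z t - c (xbar + t • d' t) =
        (t ^ 2) • ((1 / 2 : ℝ) • (r • (ζ - z) - A p) - R t) := by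
      rw [smul_sub, h1, hd', map_add, map_smul, hZ, ← hd' t]
      module
    rw [h2, norm_smul, Real.norm_of_nonneg (pow_pos ht 2).le]
  have hlim1 : Tendsto (fun t => γ * ‖d' t‖ ^ 2) l (𝓝 (γ * ‖d‖ ^ 2)) :=
    (hd'l.norm.pow 2).const_mul γ
  have hlim2 : Tendsto (fun t => r / 2 * ((h ζ).toReal - (h z).toReal) + q / 2 * (1 - θ t)⁻¹ +
      L * ‖(1 / 2 : ℝ) • (r • (ζ - z) - A p) - R t‖) l
      (𝓝 (r / 2 * ((h ζ).toReal - (h z).toReal) + q / 2 * 1 +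
      L * ‖(1 / 2 : ℝ) • (r • (ζ - z) - A p) - (1 / 2 : ℝ) • b‖)) :=
    ((hθinv.const_mul _).const_add _).add ((hR.const_sub _).norm.const_mul L)
  have hle := le_of_tendsto_of_tendsto hlim1 hlim2 (by
    filter_upwards [hpair.eventually hgrow, hZval, hres, hpos] with t h1 h2 h3 h4
    have h5 := h1 h2.1
    rw [h3, add_sub_cancel_left, norm_smul, Real.norm_of_nonneg h4.le, mul_pow] at h5
    refine le_of_mul_le_mul_left ?_ (pow_pos h4 2)
    linarith [h2.2])
  rw [← smul_sub, norm_smul, Real.norm_of_nonneg (by norm_num : (0 : ℝ) ≤ 1 / 2)] at hle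
  linarith

/-- Strong local minimality together with uniqueness of the multiplier implies the second-order
sufficient conditions. -/
theorem secondOrderSufficient_of_isStrongLocalMin (hPLQ : IsPLQ h) (hconv : IsConvexFun h)
    (hc : ContDiff ℝ 2 c) (hx : c xbar ∈ dom h) (hB : BCQ h c xbar)
    (hM : multipliers h c xbar = {ybar}) (hmin : IsStrongLocalMin (h ∘ c) xbar) :
    SecondOrderSufficient h c xbar := by
  have hprop := hPLQ.1
  have hc1 : ContDiff ℝ 1 c := hc.of_le one_le_two
  obtain ⟨M⟩ := hPLQ.nonempty_localModel (c xbar)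
  have hy : ybar ∈ multipliers h c xbar := by rw [hM]; rfl
  refine ⟨⟨ybar, hy.2, hy.1⟩, fun d hd => ?_⟩
  obtain ⟨k, hk, hg⟩ := exists_cone_of_mem_nonAscent hprop hc1 hx M hd.1
  -- Non-ascent bounds this derivative above by 0 and the multiplier bounds it below by 0, so h has
  -- no linear term along Ad.
  have hg0 : inner ℝ (M.g k) (fderiv ℝ c xbar d) = 0 := by
    have := LocalModel.inner_le hprop hy.2 hk
    rw [inner_fderiv_eq_zero hy.1] at this
    exact le_antisymm hg this
  refine ⟨_, inner ℝ d (hessLag c ybar xbar d), LocalModel.hasSecondDirDeriv hprop hx hk, ?_, ?_⟩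
  · rw [hM, Set.image_singleton]
    exact isGreatest_singleton
  obtain ⟨L, γ, hL, hγ, hgrow⟩ := hmin.exists_penalized_growth hPLQ hconv hc1 hx hB
  set q : ℝ := inner ℝ (fderiv ℝ c xbar d) (M.Q k (fderiv ℝ c xbar d)) with hq
  have hev : ∀ᶠ t in 𝓝[>] (0 : ℝ), h (c xbar + t • fderiv ℝ c xbar d) =
      (((h (c xbar)).toReal + t ^ 2 / 2 * q : ℝ) : EReal) := by
    filter_upwards [LocalModel.eventually_eq hk] with t ht
    rw [ht, hg0, mul_zero, add_zero]
  -- Duality only provides some multiplier y whose curvature term is at least 2γ‖d‖² - q; uniqueness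
  -- identifies it with ybar.
  obtain ⟨y, hy1, hy2, hy3⟩ := exists_multiplier_of_forall_le hprop hconv hx (fderiv ℝ c xbar)
    (fderiv ℝ (fderiv ℝ c) xbar d d) (σ := 2 * (γ * ‖d‖ ^ 2) - q) hL fun ζ hζ r hr p => by
      linarith [le_of_penalized_growth hprop hconv hc hgrow hev hζ hr p]
  have hyM : y ∈ multipliers h c xbar := ⟨hy2, hy1⟩
  rw [hM, Set.mem_singleton_iff] at hyM
  subst hyM
  rw [inner_hessLag hc, ← EReal.coe_add, EReal.coe_pos]
  have : 0 < γ * ‖d‖ ^ 2 := mul_pos hγ (pow_pos (norm_pos_iff.2 hd.2) 2)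
  linarith

end Necessity

end ConvexComposite

open ConvexComposite in
theorem mainTheorem1 (n m : ℕ) (h : E m → EReal) (c : E n → E m)
    (hPLQ : IsPLQ h) (hconv : IsConvexFun h) (hc : ContDiff ℝ 2 c)
    (xbar : E n) (hx : xbar ∈ dom (h ∘ c)) (hBCQ : BCQ h c xbar) (ybar : E m) :
    (multipliers h c xbar = {ybar} ∧ SecondOrderSufficient h c xbar) ↔
      (StronglyMetricallySubregular (kktMap h c) (WithLp.toLp 2 (xbar, ybar)) 0 ∧
        IsStrongLocalMin (h ∘ c) xbar) := by
  constructor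
  · rintro ⟨hM, hS⟩
    exact ⟨stronglyMetricallySubregular_of_secondOrderSufficient hPLQ hconv hc hx hBCQ hM hS,
      isStrongLocalMin_of_secondOrderSufficient hPLQ hc hx hM hS⟩
  · rintro ⟨hS, hmin⟩
    have hM := multipliers_eq_singleton_of_stronglyMetricallySubregular hPLQ hconv hS
    exact ⟨hM, secondOrderSufficient_of_isStrongLocalMin hPLQ hconv hc hx hBCQ hM hmin⟩
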